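/- Let $H$ and $U$ be real Hilbert spaces, $T>0$, $y_0\in H$, and let $A$ be a densely defined linear operator on $H$ that generates a strongly continuous semigroup $S(t)=e^{tA}$. Let $l_1,m:H\to\mathbb R$ be continuously Fréchet differentiable, and let $f:[0,T]\times H\to\mathcal L(U,H)$ be such that $t\mapsto f(t,z)$ is continuous on $[0,T]$ for every $z\in H$, $f(t,\cdot)$ is continuously Fréchet differentiable for every $t\in(0,T)$, and the derivative $f_y$ is locally bounded: every $(t_0,z_0)\in[0,T]\times H$ has a neighbourhood $W$ such that $\|f_y(t,z)\|$ is bounded for $(t,z)\in W$ with $t\in(0,T)$. Let $R:U\to U$ be bounded, self-adjoint and coercive: $\langle Rv,v\rangle_U\ge\gamma\|v\|_U^2$ for all $v\in U$ with some $\gamma>0$. For a control $u$, a mild solution of the state equation is $y\in C([0,T];H)$ with $$y(t)=S(t)y_0+\int_0^tS(t-s)f(s,y(s))u(s)\,ds,\qquad t\in[0,T].$$ If it exists and is unique, the state and the cost $$J_1(u)=\int_0^Tl_1(y(s))\,ds+m(y(T))$$ of $u$ are said to be well defined. Let the reference control $u_1:(0,T)\to U$ be continuous and integrable, let $y$ be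 a mild solution for $u=u_1$, and let $p\in C([0,T];H^*)$ be a mild solution of the adjoint problem, that is, $p(T)=m_y(y(T))$ and $$p(t)=S(T-t)^*p(T)+\int_t^TS(s-t)^*\Big(\big((f(s,y(s))u_1(s))_y\big)^*p(s)+(l_1)_y(y(s))\Big)ds,\qquad t\in[0,T].$$ For $\lambda>0$, $t\in(0,T)$ and $v\in U$ let the needle variation $u_{\lambda,t,v}$ be equal to $v$ on $[t-\frac\lambda2,t+\frac\lambda2]$ and to $u_1$ elsewhere, and let $$\frac{dJ_1}{d\lambda^+}(t,v)=\lim_{\lambda\downarrow0}\frac{J_1(u_{\lambda,t,v})-J_1(u_1)}{\lambda}$$ be the mode insertion gradient. For $\alpha_d<0$ and $\tau\in(0,T)$, a control value $u^*(\tau)$ obtained by the SAC principle is a minimizer over $v\in U$ of $$\frac12\Big[\frac{dJ_1}{d\lambda^+}(\tau,v)-\alpha_d\Big]^2+\frac12\langle v,Rv\rangle_U .$$ Then the mode insertion gradient is well defined for all $t\in(0,T)$ and $v\in U$: the state for $u_1$ is well defined, the states for $u_{\lambda,t,v}$ are well defined for all sufficiently small $\lambda>0$, and the limit exists. Moreover,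 for every $\tau\in(0,T)$ such that the functional $P(\tau):w\mapsto\langle p(\tau),f(\tau,y(\tau))w\rangle_{H^*,H}$ on $U$ is not zero, there is $\alpha_d<0$ such that a control value $u^*(\tau)$ obtained by the SAC principle exists and, for every such $u^*(\tau)$, there is a neighbourhood $N(\tau)\subset(0,T)$ of $\tau$ with $$\frac{dJ_1}{d\lambda^+}(t,u^*(\tau))<0\qquad\text{for all }t\in N(\tau),$$ and there is a duration $\bar\lambda>0$ with $[\tau-\frac{\bar\lambda}2,\tau+\frac{\bar\lambda}2]\subset N(\tau)$ such that for all $t\in[\tau-\frac{\bar\lambda}2,\tau+\frac{\bar\lambda}2]$ and all $\lambda\in(0,\bar\lambda]$ the cost of $u_{\lambda,t,u^*(\tau)}$ is well defined and $J_1(u_{\lambda,t,u^*(\tau)})\le J_1(u_1)$. -/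

import Mathlib

open Set Filter Topology MeasureTheory

/-- `S` (used only at times `t ≥ 0`) is a strongly continuous semigroup of bounded linear
operators. -/
structure IsC0Semigroup {H : Type*} [NormedAddCommGroup H] [NormedSpace ℝ H]
    (S : ℝ → H →L[ℝ] H) : Prop where
  zero : S 0 = ContinuousLinearMap.id ℝ H
  add : ∀ s t : ℝ, 0 ≤ s → 0 ≤ t → S (s + t) = (S s).comp (S t)
  continuousOn : ∀ x : H, ContinuousOn (fun t => S t x) (Ici 0)

/-- The (possibly unbounded) operator `A` is the infinitesimal generator of `S`: `x ∈ D(A)` and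
`A x = z` if and only if `(S h x - x) / h → z` as `h ↓ 0`. -/
def Generates {H : Type*} [NormedAddCommGroup H] [NormedSpace ℝ H]
    (A : H →ₗ.[ℝ] H) (S : ℝ → H →L[ℝ] H) : Prop :=
  ∀ x z : H, (∃ hx : x ∈ A.domain, A ⟨x, hx⟩ = z) ↔
    Tendsto (fun h : ℝ => h⁻¹ • (S h x - x)) (𝓝[>] 0) (𝓝 z)

/-- The data of the stage problem
`min J₁(u) = ∫₀ᵀ l₁(y(s)) ds + m(y(T))` subject to `y' = A y + f(t, y) u`, `y(0) = y₀`;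
`S` is the semigroup generated by `A`. -/
structure StageProblem (H U : Type*) [NormedAddCommGroup H] [NormedSpace ℝ H]
    [NormedAddCommGroup U] [NormedSpace ℝ U] where
  T : ℝ
  A : H →ₗ.[ℝ] H
  S : ℝ → H →L[ℝ] H
  f : ℝ → H → U →L[ℝ] H
  l₁ : H → ℝ
  m : H → ℝ
  y₀ : H

namespace StageProblem

variable {H U : Type*} [NormedAddCommGroup H] [InnerProductSpace ℝ H]
  [NormedAddCommGroup U] [InnerProductSpace ℝ U]

/-- The standing assumptions on the data. -/
structure Assumptions (Q : StageProblem H U) : Prop where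
  T_pos : 0 < Q.T
  dense_domain : Dense (Q.A.domain : Set H)
  semigroup : IsC0Semigroup Q.S
  generates : Generates Q.A Q.S
  l₁_contDiff : ContDiff ℝ 1 Q.l₁
  m_contDiff : ContDiff ℝ 1 Q.m
  f_continuous_time : ∀ z : H, ContinuousOn (fun t => Q.f t z) (Icc 0 Q.T)
  f_contDiff : ∀ t ∈ Ioo 0 Q.T, ContDiff ℝ 1 (Q.f t)
  /-- the derivative of `f` in the state is bounded near every point of `[0, T] × H` -/
  f_deriv_locally_bounded : ∀ t₀ ∈ Icc 0 Q.T, ∀ z₀ : H, ∃ δ > 0, ∃ C : ℝ,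
    ∀ t ∈ Ioo 0 Q.T, |t - t₀| < δ → ∀ z : H, ‖z - z₀‖ < δ → ‖fderiv ℝ (Q.f t) z‖ ≤ C

/-- `y ∈ C([0,T]; H)` is a mild solution of the state equation with control `u`. -/
structure IsMildSolution (Q : StageProblem H U) (u : ℝ → U) (y : ℝ → H) : Prop where
  continuousOn : ContinuousOn y (Icc 0 Q.T)
  integrable : ∀ t ∈ Icc 0 Q.T,
    IntervalIntegrable (fun s => Q.S (t - s) (Q.f s (y s) (u s))) volume 0 t
  eq : ∀ t ∈ Icc 0 Q.T, y t = Q.S t Q.y₀ + ∫ s in (0 : ℝ)..t, Q.S (t - s) (Q.f s (y s) (u s))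

/-- The source term `((f(s, y(s)) u(s))_y)^* p(s) + (l₁)_y(y(s))` of the adjoint equation, an
element of the dual of `H`. -/
noncomputable def adjointSource (Q : StageProblem H U) (u : ℝ → U) (y : ℝ → H)
    (p : ℝ → H →L[ℝ] ℝ) (s : ℝ) : H →L[ℝ] ℝ :=
  (p s).comp (fderiv ℝ (fun z => Q.f s z (u s)) (y s)) + fderiv ℝ Q.l₁ (y s)

/-- `p ∈ C([0,T]; H^*)` is the mild solution of the adjoint equation belonging to the control `u`
and the state `y`. The dual operator `e^{r A^*}` is `q ↦ q ∘ e^{r A}`. -/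
structure IsMildAdjoint (Q : StageProblem H U) (u : ℝ → U) (y : ℝ → H)
    (p : ℝ → H →L[ℝ] ℝ) : Prop where
  continuousOn : ContinuousOn p (Icc 0 Q.T)
  terminal : p Q.T = fderiv ℝ Q.m (y Q.T)
  integrable : ∀ t ∈ Icc 0 Q.T,
    IntervalIntegrable (fun s => (Q.adjointSource u y p s).comp (Q.S (s - t))) volume t Q.T
  eq : ∀ t ∈ Icc 0 Q.T, p t = (p Q.T).comp (Q.S (Q.T - t)) +
    ∫ s in t..Q.T, (Q.adjointSource u y p s).comp (Q.S (s - t))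

/-- The state equation with control `u` has exactly one mild solution on `[0, T]`. -/
def HasUniqueState (Q : StageProblem H U) (u : ℝ → U) : Prop :=
  ∃ y, Q.IsMildSolution u y ∧ ∀ z, Q.IsMildSolution u z → EqOn z y (Icc 0 Q.T)

open Classical in
/-- The mild solution of the state equation with control `u`; meaningful (on `[0, T]`) if
`Q.HasUniqueState u`. -/
noncomputable def state (Q : StageProblem H U) (u : ℝ → U) : ℝ → H :=
  if h : ∃ y, Q.IsMildSolution u y then h.choose else 0

/-- The cost `J₁(u)`; meaningful if `Q.HasUniqueState u`. -/
noncomputable def cost (Q : StageProblem H U) (u : ℝ → U) : ℝ :=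
  (∫ s in (0 : ℝ)..Q.T, Q.l₁ (Q.state u s)) + Q.m (Q.state u Q.T)

open Classical in
/-- The needle variation `u_{lam, τ, v}` of `u₁`. -/
noncomputable def needle (u₁ : ℝ → U) (lam τ : ℝ) (v : U) : ℝ → U :=
  fun t => if t ∈ Icc (τ - lam / 2) (τ + lam / 2) then v else u₁ t

/-- The difference quotient `(J₁(u_{lam, τ, v}) - J₁(u₁)) / lam`. -/
noncomputable def migQuotient (Q : StageProblem H U) (u₁ : ℝ → U) (τ : ℝ) (v : U) (lam : ℝ) : ℝ :=
  (Q.cost (needle u₁ lam τ v) - Q.cost u₁) / lam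

/-- The mode insertion gradient, the limit of the difference quotients as `lam ↓ 0`; meaningful if
`Q.MigExists u₁ τ v`. -/
noncomputable def mig (Q : StageProblem H U) (u₁ : ℝ → U) (τ : ℝ) (v : U) : ℝ :=
  limUnder (𝓝[>] (0 : ℝ)) (Q.migQuotient u₁ τ v)

/-- The mode insertion gradient is well defined: the costs in the difference quotient are well
defined for all small `lam > 0`, and the limit exists. -/
def MigExists (Q : StageProblem H U) (u₁ : ℝ → U) (τ : ℝ) (v : U) : Prop :=
  Q.HasUniqueState u₁ ∧ (∀ᶠ lam in 𝓝[>] (0 : ℝ), Q.HasUniqueState (needle u₁ lam τ v)) ∧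
    Tendsto (Q.migQuotient u₁ τ v) (𝓝[>] 0) (𝓝 (Q.mig u₁ τ v))

/-- The objective `l₂` of the SAC subproblem at the application time `τ`. -/
noncomputable def sacObjective (Q : StageProblem H U) (R : U →L[ℝ] U) (u₁ : ℝ → U)
    (αd τ : ℝ) (v : U) : ℝ :=
  1 / 2 * (Q.mig u₁ τ v - αd) ^ 2 + 1 / 2 * inner ℝ v (R v)

/-- `v` is a control value `u^*(τ)` obtained by the SAC principle: a minimizer of `l₂` over `U`. -/
def IsSACControl (Q : StageProblem H U) (R : U →L[ℝ] U) (u₁ : ℝ → U) (αd τ : ℝ) (v : U) : Prop :=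
  IsMinOn (Q.sacObjective R u₁ αd τ) univ v

end StageProblem

/-! Let z be the state for a control u near `u₁`. Subtracting the two state equations writes z - y
as a convolution of the semigroup with f(s,z)u - f(s,y)u₁. Pairing this source with p and exchanging
the order of integration (`integral_adjoint_apply`) gives an exact formula for J₁(u) - J₁(u₁)
(`cost_increment`): the first-order remainder of m, plus the integrated first-order remainder of the
Hamiltonian l₁(x) + p(f(s,x)u₁), plus ∫ p(f(s,z)(u - u₁)).

For a needle of length λ the state moves by O(λ) (`eventually_hasUniqueState_needle`). Both
remainders are then o(λ), and the last term divided by λ tends to p(t) f(t,y(t))(v - u₁(t)). Every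
limit is taken in λ and in the needle's position jointly, so a negative limit at τ forces descent
for all short needles near τ with one common duration.

The mode insertion gradient is thus affine in v, with linear part P(τ), and the SAC objective is a
coercive quadratic. For a sufficiently negative target its minimizer makes the gradient negative
(`exists_target_minimizer_lt`).

The derivative of f is only locally bounded. Estimates are therefore made in tubes around continuous
curves, by compactness of [0,T]; states exist by Picard iteration in such a tube and are unique by
Gronwall. -/

/-- A map that is continuous in its first variable and locally Lipschitz in its second one,
locally uniformly in the first, is jointly continuous. -/
theorem continuousAt_uncurry_of_eventually_norm_sub_le {α X Y : Type*} [TopologicalSpace α]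
    [SeminormedAddCommGroup X] [SeminormedAddCommGroup Y] {g : α → X → Y} {t₀ : α} {x₀ : X} (C : ℝ)
    (hlip : ∀ᶠ w : α × X in 𝓝 (t₀, x₀), ‖g w.1 w.2 - g w.1 x₀‖ ≤ C * ‖w.2 - x₀‖)
    (hc : ContinuousAt (fun t => g t x₀) t₀) :
    ContinuousAt (fun w : α × X => g w.1 w.2) (t₀, x₀) := by
  have h1 : Tendsto (fun w : α × X => g w.1 w.2 - g w.1 x₀) (𝓝 (t₀, x₀)) (𝓝 0) := by
    refine squeeze_zero_norm' hlip ?_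
    have : Continuous fun w : α × X => C * ‖w.2 - x₀‖ := by fun_prop
    simpa using this.tendsto (t₀, x₀)
  have h2 : Tendsto (fun w : α × X => g w.1 x₀) (𝓝 (t₀, x₀)) (𝓝 (g t₀ x₀)) :=
    hc.tendsto.comp (continuous_fst.tendsto (t₀, x₀))
  simpa [ContinuousAt] using h1.add h2

/-! ### Gronwall's inequality and Picard iteration with an integrable kernel -/

section Volterra

variable {k : ℝ → ℝ} {T : ℝ}

theorem continuousOn_primitive_Icc {E : Type*} [NormedAddCommGroup E] [NormedSpace ℝ E]
    {k : ℝ → E} (hT : 0 ≤ T) (hki : IntervalIntegrable k volume 0 T) :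
    ContinuousOn (fun t => ∫ s in (0 : ℝ)..t, k s) (Icc 0 T) := by
  have := intervalIntegral.continuousOn_primitive_interval' hki (left_mem_uIcc)
  rwa [uIcc_of_le hT] at this

theorem IntervalIntegrable.mono_Icc {E : Type*} [NormedAddCommGroup E] {k : ℝ → E}
    (hki : IntervalIntegrable k volume 0 T) {a b : ℝ} (ha : a ∈ Icc 0 T) (hb : b ∈ Icc 0 T) :
    IntervalIntegrable k volume a b := by
  refine hki.mono_set (uIcc_subset_uIcc ?_ ?_) <;>
  · rw [uIcc_of_le (ha.1.trans ha.2)]; assumption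

theorem intervalIntegrable_mul_exp_primitive (hT : 0 ≤ T)
    (hki : IntervalIntegrable k volume 0 T) (c : ℝ) :
    IntervalIntegrable (fun s => k s * Real.exp (c * ∫ r in (0 : ℝ)..s, k r)) volume 0 T := by
  refine hki.mul_continuousOn ?_
  rw [uIcc_of_le hT]
  exact (continuousOn_const.mul (continuousOn_primitive_Icc hT hki)).rexp

/-- With K the primitive of k, the weight e^{cK} makes φ ↦ ∫ k φ a contraction with factor 1/c for c
> 1. The kernel may blow up at 0 and T, so the fundamental theorem of calculus is used with
derivatives in the open interval only. -/
theorem integral_mul_exp_primitive (hT : 0 ≤ T) (hk : ContinuousOn k (Ioo 0 T))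
    (hki : IntervalIntegrable k volume 0 T) {c : ℝ} (hc : c ≠ 0) {t : ℝ} (ht : t ∈ Icc 0 T) :
    ∫ s in (0 : ℝ)..t, k s * Real.exp (c * ∫ r in (0 : ℝ)..s, k r) =
      (Real.exp (c * ∫ r in (0 : ℝ)..t, k r) - 1) / c := by
  have h0 : (0 : ℝ) ∈ Icc 0 T := ⟨le_rfl, hT⟩
  have h := intervalIntegral.integral_eq_sub_of_hasDerivAt_of_le ht.1
    (f := fun s => Real.exp (c * ∫ r in (0 : ℝ)..s, k r) / c)
    (f' := fun s => k s * Real.exp (c * ∫ r in (0 : ℝ)..s, k r)) ?_ ?_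
    ((intervalIntegrable_mul_exp_primitive hT hki c).mono_Icc h0 ht)
  · rw [h]; simp; ring
  · exact ((continuousOn_const.mul ((continuousOn_primitive_Icc hT hki).mono
      (Icc_subset_Icc_right ht.2))).rexp).div_const c
  · intro s hs
    have hs' : s ∈ Ioo 0 T := ⟨hs.1, hs.2.trans_le ht.2⟩
    have hd : HasDerivAt (fun s => ∫ r in (0 : ℝ)..s, k r) (k s) s :=
      intervalIntegral.integral_hasDerivAt_right (hki.mono_Icc h0 ⟨hs'.1.le, hs'.2.le⟩)
        (hk.stronglyMeasurableAtFilter isOpen_Ioo s hs') (hk.continuousAt (isOpen_Ioo.mem_nhds hs'))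
    exact (((hd.const_mul c).exp).div_const c).congr_deriv (by field_simp)

theorem primitive_nonneg (hk0 : ∀ s, 0 ≤ k s) {t : ℝ} (ht : 0 ≤ t) :
    0 ≤ ∫ s in (0 : ℝ)..t, k s :=
  intervalIntegral.integral_nonneg ht fun s _ => hk0 s

theorem primitive_mono (hk0 : ∀ s, 0 ≤ k s) (hki : IntervalIntegrable k volume 0 T) {t : ℝ}
    (ht : t ∈ Icc 0 T) : ∫ s in (0 : ℝ)..t, k s ≤ ∫ s in (0 : ℝ)..T, k s :=
  intervalIntegral.integral_mono_interval le_rfl ht.1 ht.2 (ae_of_all _ hk0) hki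

/-- If `φ ≤ C e^{cK}`, where `K` is the primitive of `k`, then `∫ k φ ≤ (C / c) e^{cK}`. -/
theorem integral_mul_le_of_le_exp_primitive (hT : 0 ≤ T) (hk : ContinuousOn k (Ioo 0 T))
    (hk0 : ∀ s, 0 ≤ k s) (hki : IntervalIntegrable k volume 0 T) {c : ℝ} (hc : 0 < c) {C : ℝ}
    {φ : ℝ → ℝ} (hφ : ContinuousOn φ (Icc 0 T))
    (hle : ∀ t ∈ Icc 0 T, φ t ≤ C * Real.exp (c * ∫ r in (0 : ℝ)..t, k r)) {t : ℝ}
    (ht : t ∈ Icc 0 T) :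
    ∫ s in (0 : ℝ)..t, k s * φ s ≤ C * ((Real.exp (c * ∫ r in (0 : ℝ)..t, k r) - 1) / c) := by
  have h0 : (0 : ℝ) ∈ Icc 0 T := ⟨le_rfl, hT⟩
  rw [← integral_mul_exp_primitive hT hk hki hc.ne' ht, ← intervalIntegral.integral_const_mul]
  have hi : IntervalIntegrable (fun s => k s * φ s) volume 0 T :=
    hki.mul_continuousOn (by rwa [uIcc_of_le hT])
  refine intervalIntegral.integral_mono_on ht.1 (hi.mono_Icc h0 ht)
    (((intervalIntegrable_mul_exp_primitive hT hki c).mono_Icc h0 ht).const_mul C) fun s hs => ?_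
  have := mul_le_mul_of_nonneg_left (hle s ⟨hs.1, hs.2.trans ht.2⟩) (hk0 s)
  linarith

/-- Gronwall by iteration: reinserting the bound with weight e^{2K} halves its constant each time.
-/
theorem nonpos_of_le_integral_mul (hT : 0 ≤ T) (hk : ContinuousOn k (Ioo 0 T))
    (hk0 : ∀ s, 0 ≤ k s) (hki : IntervalIntegrable k volume 0 T) {φ : ℝ → ℝ}
    (hφ : ContinuousOn φ (Icc 0 T))
    (hle : ∀ t ∈ Icc 0 T, φ t ≤ ∫ s in (0 : ℝ)..t, k s * φ s) : ∀ t ∈ Icc 0 T, φ t ≤ 0 := by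
  obtain ⟨C, hC⟩ := isCompact_Icc.bddAbove_image hφ
  have hC' : ∀ t ∈ Icc 0 T, φ t ≤ max C 0 := fun t ht =>
    (hC (mem_image_of_mem _ ht)).trans (le_max_left _ _)
  have hn : ∀ n : ℕ, ∀ t ∈ Icc 0 T,
      φ t ≤ (max C 0 * (1 / 2) ^ n) * Real.exp (2 * ∫ r in (0 : ℝ)..t, k r) := by
    intro n
    induction n with
    | zero =>
      intro t ht
      have : 1 ≤ Real.exp (2 * ∫ r in (0 : ℝ)..t, k r) :=
        Real.one_le_exp (mul_nonneg two_pos.le (primitive_nonneg hk0 ht.1))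
      have h2 := mul_le_mul_of_nonneg_left this (le_max_right C 0)
      have := hC' t ht
      simp only [pow_zero, mul_one] at *
      linarith
    | succ n ih =>
      intro t ht
      refine (hle t ht).trans ((integral_mul_le_of_le_exp_primitive hT hk hk0 hki two_pos hφ ih
        ht).trans ?_)
      have : 0 ≤ max C 0 * (1 / 2) ^ n := by positivity
      rw [pow_succ]
      nlinarith
  intro t ht
  have hlim : Tendsto (fun n : ℕ => (max C 0 * (1 / 2 : ℝ) ^ n) *
      Real.exp (2 * ∫ r in (0 : ℝ)..t, k r)) atTop (𝓝 0) := by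
    simpa using ((tendsto_pow_atTop_nhds_zero_of_lt_one (r := (1 / 2 : ℝ)) (by norm_num)
      (by norm_num)).const_mul (max C 0)).mul_const (Real.exp (2 * ∫ r in (0 : ℝ)..t, k r))
  exact ge_of_tendsto' hlim fun n => hn n t ht

/-- Picard iteration for a Volterra operator in a tube around a curve `y`. -/
theorem exists_fixedPoint_in_tube {H : Type*} [NormedAddCommGroup H] [CompleteSpace H]
    (hT : 0 ≤ T) (hk : ContinuousOn k (Ioo 0 T)) (hk0 : ∀ s, 0 ≤ k s)
    (hki : IntervalIntegrable k volume 0 T) {Φ : (ℝ → H) → ℝ → H} {y : ℝ → H} {δ a : ℝ}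
    (ha : 0 ≤ a) (hy : ContinuousOn y (Icc 0 T))
    (hΦ : ∀ z, ContinuousOn z (Icc 0 T) → ContinuousOn (Φ z) (Icc 0 T))
    (hlip : ∀ z z', ContinuousOn z (Icc 0 T) → ContinuousOn z' (Icc 0 T) →
      (∀ s ∈ Icc 0 T, ‖z s - y s‖ ≤ δ) → (∀ s ∈ Icc 0 T, ‖z' s - y s‖ ≤ δ) →
      ∀ t ∈ Icc 0 T, ‖Φ z t - Φ z' t‖ ≤ ∫ s in (0 : ℝ)..t, k s * ‖z s - z' s‖)
    (hya : ∀ t ∈ Icc 0 T, ‖Φ y t - y t‖ ≤ a)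
    (haδ : a * Real.exp (∫ s in (0 : ℝ)..T, k s) ≤ δ) :
    ∃ z, ContinuousOn z (Icc 0 T) ∧
      (∀ t ∈ Icc 0 T, ‖z t - y t‖ ≤ a * Real.exp (∫ s in (0 : ℝ)..T, k s)) ∧
      ∀ t ∈ Icc 0 T, z t = Φ z t := by
  set K : ℝ → ℝ := fun t => ∫ s in (0 : ℝ)..t, k s with hK
  have hKm : ∀ t ∈ Icc 0 T, K t ≤ K T := fun t ht => primitive_mono hk0 hki ht
  have hK0 : ∀ t ∈ Icc 0 T, 0 ≤ K t := fun t ht => primitive_nonneg hk0 ht.1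
  have hδ : 0 ≤ δ := le_trans (by positivity) haδ
  have htube : ∀ t ∈ Icc 0 T, a * Real.exp (K t) ≤ a * Real.exp (K T) := fun t ht =>
    mul_le_mul_of_nonneg_left (Real.exp_le_exp.2 (hKm t ht)) ha
  set z : ℕ → ℝ → H := fun n => Φ^[n] y with hz
  have hzs : ∀ n, z (n + 1) = Φ (z n) := fun n => Function.iterate_succ_apply' Φ n y
  have hcont : ∀ n, ContinuousOn (z n) (Icc 0 T) := by
    intro n
    induction n with
    | zero => exact hy
    | succ n ih => rw [hzs]; exact hΦ _ ih
  have hyδ : ∀ s ∈ Icc 0 T, ‖y s - y s‖ ≤ δ := fun s _ => by simpa using hδ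
  -- The bound a e^{K(t)} reproduces itself, a + a(e^{K(t)} - 1) = a e^{K(t)}, so the iterates never
  -- leave the tube in which the Lipschitz estimate is available.
  have hinv : ∀ n, ∀ t ∈ Icc 0 T, ‖z n t - y t‖ ≤ a * Real.exp (K t) := by
    intro n
    induction n with
    | zero => intro t ht; simp [hz]; positivity
    | succ n ih =>
      intro t ht
      rw [hzs]
      have h1 := hlip (z n) y (hcont n) hy
        (fun s hs => (ih s hs).trans ((htube s hs).trans haδ)) hyδ t ht
      have h2 := integral_mul_le_of_le_exp_primitive (C := a) hT hk hk0 hki one_pos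
        ((hcont n).sub hy).norm (by simpa using ih) ht
      have h3 := norm_sub_le_norm_sub_add_norm_sub (Φ (z n) t) (Φ y t) (y t)
      have h4 := hya t ht
      simp only [one_mul, div_one, Pi.sub_apply] at h2
      change _ ≤ a * (Real.exp (K t) - 1) at h2
      linarith
  have hinδ : ∀ n, ∀ t ∈ Icc 0 T, ‖z n t - y t‖ ≤ δ := fun n t ht =>
    (hinv n t ht).trans ((htube t ht).trans haδ)
  -- In the weight e^{2K} successive differences halve.
  have hstep : ∀ n, ∀ t ∈ Icc 0 T,
      ‖z (n + 1) t - z n t‖ ≤ (a * (1 / 2) ^ n) * Real.exp (2 * K t) := by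
    intro n
    induction n with
    | zero =>
      intro t ht
      have h1 : 1 ≤ Real.exp (2 * K t) := Real.one_le_exp (mul_nonneg two_pos.le (hK0 t ht))
      have h2 := hya t ht
      rw [hzs]
      simp only [pow_zero, mul_one]
      exact h2.trans (le_mul_of_one_le_right ha h1)
    | succ n ih =>
      intro t ht
      rw [hzs (n + 1), hzs n]
      rw [← hzs n]
      have h1 := hlip (z (n + 1)) (z n) (hcont _) (hcont _) (hinδ _) (hinδ _) t ht
      have h2 := integral_mul_le_of_le_exp_primitive hT hk hk0 hki two_pos
        ((hcont (n + 1)).sub (hcont n)).norm ih ht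
      rw [← hzs n] at h1
      refine h1.trans (h2.trans ?_)
      have : 0 ≤ a * (1 / 2) ^ n := by positivity
      rw [pow_succ]
      simp only [hK]
      nlinarith
  set D : ℝ := a * Real.exp (2 * K T) with hD
  have hgeo : ∀ t ∈ Icc 0 T, ∀ n, dist (z n t) (z (n + 1) t) ≤ D * (1 / 2) ^ n := by
    intro t ht n
    rw [dist_comm, dist_eq_norm]
    refine (hstep n t ht).trans ?_
    have : Real.exp (2 * K t) ≤ Real.exp (2 * K T) :=
      Real.exp_le_exp.2 (mul_le_mul_of_nonneg_left (hKm t ht) two_pos.le)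
    rw [hD, mul_right_comm]
    gcongr
  have hlim : ∀ t : ℝ, ∃ w, t ∈ Icc 0 T → Tendsto (fun n => z n t) atTop (𝓝 w) := by
    intro t
    by_cases ht : t ∈ Icc 0 T
    · obtain ⟨w, hw⟩ := cauchySeq_tendsto_of_complete
        (cauchySeq_of_le_geometric (1 / 2) D (by norm_num) (hgeo t ht))
      exact ⟨w, fun _ => hw⟩
    · exact ⟨0, fun h => absurd h ht⟩
  choose w hw using hlim
  have hdist : ∀ t ∈ Icc 0 T, ∀ n, ‖z n t - w t‖ ≤ D * (1 / 2) ^ n / (1 - 1 / 2) := by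
    intro t ht n
    rw [← dist_eq_norm]
    exact dist_le_of_le_geometric_of_tendsto (1 / 2) D (by norm_num) (hgeo t ht) (hw t ht) n
  have hD0 : Tendsto (fun n : ℕ => D * (1 / 2 : ℝ) ^ n / (1 - 1 / 2)) atTop (𝓝 0) := by
    simpa using ((tendsto_pow_atTop_nhds_zero_of_lt_one (r := (1 / 2 : ℝ)) (by norm_num)
      (by norm_num)).const_mul D).div_const (1 - 1 / 2)
  have hunif : TendstoUniformlyOn z w atTop (Icc 0 T) := by
    rw [Metric.tendstoUniformlyOn_iff]
    intro ε hε
    filter_upwards [hD0.eventually_lt_const hε] with n hn t ht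
    rw [dist_comm, dist_eq_norm]
    exact (hdist t ht n).trans_lt hn
  have hwc : ContinuousOn w (Icc 0 T) := hunif.continuousOn (Frequently.of_forall hcont)
  have hwy : ∀ t ∈ Icc 0 T, ‖w t - y t‖ ≤ a * Real.exp (K T) := fun t ht =>
    le_of_tendsto' ((hw t ht).sub_const (y t)).norm fun n => (hinv n t ht).trans (htube t ht)
  refine ⟨w, hwc, hwy, fun t ht => ?_⟩
  have h0 : (0 : ℝ) ∈ Icc 0 T := ⟨le_rfl, hT⟩
  refine tendsto_nhds_unique ((tendsto_add_atTop_iff_nat 1).2 (hw t ht)) ?_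
  rw [tendsto_iff_norm_sub_tendsto_zero]
  refine squeeze_zero (g := fun n : ℕ => K t * (D * (1 / 2 : ℝ) ^ n / (1 - 1 / 2)))
    (fun n => norm_nonneg _) (fun n => ?_) (by simpa using hD0.const_mul (K t))
  rw [hzs]
  refine (hlip (z n) w (hcont n) hwc (hinδ n) (fun s hs => (hwy s hs).trans haδ) t ht).trans ?_
  rw [← intervalIntegral.integral_mul_const]
  have hi : IntervalIntegrable (fun s => k s * ‖z n s - w s‖) volume 0 T :=
    hki.mul_continuousOn (by rw [uIcc_of_le hT]; exact ((hcont n).sub hwc).norm)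
  exact intervalIntegral.integral_mono_on ht.1 (hi.mono_Icc h0 ht)
    ((hki.mono_Icc h0 ht).mul_const _) fun s hs =>
      mul_le_mul_of_nonneg_left (hdist s ⟨hs.1, hs.2.trans ht.2⟩ n) (hk0 s)

end Volterra

/-! ### From local to uniform estimates by compactness -/

theorem IsCompact.exists_forall_le_const_mul {α : Type*} [TopologicalSpace α] {s : Set α}
    (hs : IsCompact s) {ψ φ : α → ℝ} (hφ : ∀ t ∈ s, 0 ≤ φ t)
    (h : ∀ t ∈ s, ∃ C : ℝ, ∀ᶠ t' in 𝓝[s] t, ψ t' ≤ C * φ t') :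
    ∃ C : ℝ, 0 ≤ C ∧ ∀ t ∈ s, ψ t ≤ C * φ t := by
  -- The doubled membership keeps `t ∈ s` available for the sets of the compactness induction, which
  -- need not lie in `s`.
  suffices ∃ C : ℝ, 0 ≤ C ∧ ∀ t ∈ s, t ∈ s → ψ t ≤ C * φ t by
    obtain ⟨C, h0, h1⟩ := this
    exact ⟨C, h0, fun t ht => h1 t ht ht⟩
  refine hs.induction_on (p := fun A => ∃ C : ℝ, 0 ≤ C ∧ ∀ t ∈ A, t ∈ s → ψ t ≤ C * φ t)
    ⟨0, le_rfl, by simp⟩ ?_ ?_ ?_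
  · rintro A B hAB ⟨C, h0, hC⟩
    exact ⟨C, h0, fun t ht => hC t (hAB ht)⟩
  · rintro A B ⟨C, h0, hC⟩ ⟨D, hD0, hD⟩
    refine ⟨max C D, h0.trans (le_max_left _ _), ?_⟩
    rintro t (ht | ht) hts
    · exact (hC t ht hts).trans (mul_le_mul_of_nonneg_right (le_max_left _ _) (hφ t hts))
    · exact (hD t ht hts).trans (mul_le_mul_of_nonneg_right (le_max_right _ _) (hφ t hts))
  · intro t ht
    obtain ⟨C, hC⟩ := h t ht
    refine ⟨_, hC, max C 0, le_max_right _ _, fun t' ht' hts => ?_⟩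
    exact (show ψ t' ≤ C * φ t' from ht').trans
      (mul_le_mul_of_nonneg_right (le_max_left _ _) (hφ t' hts))

/-- `g` is Lipschitz in its second variable near every point, locally uniformly in the first
variable as long as it stays in `s`. -/
def LocallyLipschitzInState {X Y : Type*} [NormedAddCommGroup X] [NormedAddCommGroup Y]
    (g : ℝ → X → Y) (s : Set ℝ) : Prop :=
  ∀ t₀ ∈ s, ∀ z₀ : X, ∃ δ > 0, ∃ C : ℝ, 0 ≤ C ∧ ∀ t ∈ s, |t - t₀| < δ → ∀ z z' : X,
    ‖z - z₀‖ < δ → ‖z' - z₀‖ < δ → ‖g t z - g t z'‖ ≤ C * ‖z - z'‖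

namespace LocallyLipschitzInState

variable {X Y : Type*} [NormedAddCommGroup X] [NormedAddCommGroup Y] {g : ℝ → X → Y} {s : Set ℝ}

theorem of_contDiff [NormedSpace ℝ X] [NormedSpace ℝ Y] {l : X → Y} (hl : ContDiff ℝ 1 l) :
    LocallyLipschitzInState (fun _ => l) s := by
  intro t₀ _ z₀
  obtain ⟨K, A, hA, hK⟩ := (hl.contDiffAt (x := z₀)).exists_lipschitzOnWith
  obtain ⟨δ, hδ, hball⟩ := Metric.mem_nhds_iff.1 hA
  refine ⟨δ, hδ, K, K.2, fun t _ _ z z' hz hz' => ?_⟩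
  rw [← dist_eq_norm, ← dist_eq_norm]
  exact hK.dist_le_mul _ (hball (by rwa [mem_ball_iff_norm])) _
    (hball (by rwa [mem_ball_iff_norm]))

/-- A uniform Lipschitz estimate in a tube around a continuous curve. -/
theorem exists_tube (hg : LocallyLipschitzInState g s) (hs : IsCompact s) {y : ℝ → X}
    (hy : ContinuousOn y s) :
    ∃ δ > 0, ∃ C : ℝ, 0 ≤ C ∧ ∀ t ∈ s, ∀ z z' : X, ‖z - y t‖ ≤ δ → ‖z' - y t‖ ≤ δ →
      ‖g t z - g t z'‖ ≤ C * ‖z - z'‖ := by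
  suffices ∃ δ > 0, ∃ C : ℝ, 0 ≤ C ∧ ∀ t ∈ s, t ∈ s → ∀ z z' : X, ‖z - y t‖ ≤ δ →
      ‖z' - y t‖ ≤ δ → ‖g t z - g t z'‖ ≤ C * ‖z - z'‖ by
    obtain ⟨δ, hδ, C, h0, h1⟩ := this
    exact ⟨δ, hδ, C, h0, fun t ht => h1 t ht ht⟩
  refine hs.induction_on (p := fun A => ∃ δ > 0, ∃ C : ℝ, 0 ≤ C ∧ ∀ t ∈ A, t ∈ s → ∀ z z' : X,
    ‖z - y t‖ ≤ δ → ‖z' - y t‖ ≤ δ → ‖g t z - g t z'‖ ≤ C * ‖z - z'‖)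
    ⟨1, one_pos, 0, le_rfl, by simp⟩ ?_ ?_ ?_
  · rintro A B hAB ⟨δ, hδ, C, h0, hC⟩
    exact ⟨δ, hδ, C, h0, fun t ht => hC t (hAB ht)⟩
  · rintro A B ⟨δ, hδ, C, h0, hC⟩ ⟨η, hη, D, hD0, hD⟩
    refine ⟨min δ η, lt_min hδ hη, max C D, h0.trans (le_max_left _ _), ?_⟩
    rintro t (ht | ht) hts z z' hz hz'
    · exact (hC t ht hts z z' (hz.trans (min_le_left _ _)) (hz'.trans (min_le_left _ _))).trans
        (mul_le_mul_of_nonneg_right (le_max_left _ _) (norm_nonneg _))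
    · exact (hD t ht hts z z' (hz.trans (min_le_right _ _)) (hz'.trans (min_le_right _ _))).trans
        (mul_le_mul_of_nonneg_right (le_max_right _ _) (norm_nonneg _))
  · intro t₀ ht₀
    obtain ⟨δ, hδ, C, h0, hC⟩ := hg t₀ ht₀ (y t₀)
    have h1 : ∀ᶠ t in 𝓝[s] t₀, ‖y t - y t₀‖ < δ / 2 := by
      have := ((hy t₀ ht₀).sub_const (y t₀)).norm
      refine Tendsto.eventually_lt_const (u := δ / 2) ?_ this
      simpa using half_pos hδ
    have h2 : ∀ᶠ t in 𝓝[s] t₀, |t - t₀| < δ := by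
      filter_upwards [nhdsWithin_le_nhds (Metric.ball_mem_nhds t₀ hδ)] with t ht
      rwa [← Real.dist_eq]
    -- δ/4 around `y t` together with δ/2 between `y t` and `y t₀` stays inside the δ-ball of the
    -- local estimate.
    refine ⟨_, h1.and h2, δ / 4, by positivity, C, h0, ?_⟩
    rintro t ⟨ht1, ht2⟩ hts z z' hz hz'
    refine hC t hts ht2 z z' ?_ ?_
    · linarith [norm_sub_le_norm_sub_add_norm_sub z (y t) (y t₀)]
    · linarith [norm_sub_le_norm_sub_add_norm_sub z' (y t) (y t₀)]

/-- A Lipschitz estimate between two continuous curves. -/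
theorem exists_const (hg : LocallyLipschitzInState g s) (hs : IsCompact s)
    (hc : ∀ y : ℝ → X, ContinuousOn y s → ContinuousOn (fun t => g t (y t)) s) {y z : ℝ → X}
    (hy : ContinuousOn y s) (hz : ContinuousOn z s) :
    ∃ C : ℝ, 0 ≤ C ∧ ∀ t ∈ s, ‖g t (y t) - g t (z t)‖ ≤ C * ‖y t - z t‖ := by
  refine hs.exists_forall_le_const_mul (fun t _ => norm_nonneg _) fun t₀ ht₀ => ?_
  -- Near a meeting point of the curves the local Lipschitz bound applies; elsewhere the quotient of
  -- the two norms is continuous, hence locally bounded. No Lipschitz bound on the region between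
  -- the curves is needed.
  by_cases h : y t₀ = z t₀
  · obtain ⟨δ, hδ, C, h0, hC⟩ := hg t₀ ht₀ (y t₀)
    refine ⟨C, ?_⟩
    have h1 : ∀ᶠ t in 𝓝[s] t₀, ‖y t - y t₀‖ < δ := by
      have := ((hy t₀ ht₀).sub_const (y t₀)).norm
      refine Tendsto.eventually_lt_const (u := δ) ?_ this
      simpa using hδ
    have h3 : ∀ᶠ t in 𝓝[s] t₀, ‖z t - y t₀‖ < δ := by
      have := ((hz t₀ ht₀).sub_const (y t₀)).norm
      refine Tendsto.eventually_lt_const (u := δ) ?_ this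
      simpa [h] using hδ
    have h2 : ∀ᶠ t in 𝓝[s] t₀, |t - t₀| < δ := by
      filter_upwards [nhdsWithin_le_nhds (Metric.ball_mem_nhds t₀ hδ)] with t ht
      rwa [← Real.dist_eq]
    filter_upwards [h1, h2, h3, self_mem_nhdsWithin] with t h1 h2 h3 hts
    exact hC t hts h2 _ _ h1 h3
  · have hd : ContinuousWithinAt
        (fun t => ‖g t (y t) - g t (z t)‖ / ‖y t - z t‖) s t₀ :=
      (((hc y hy).sub (hc z hz)).norm t₀ ht₀).div (((hy.sub hz).norm) t₀ ht₀)
        (by simpa [sub_eq_zero] using h)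
    refine ⟨‖g t₀ (y t₀) - g t₀ (z t₀)‖ / ‖y t₀ - z t₀‖ + 1, ?_⟩
    have hne : ∀ᶠ t in 𝓝[s] t₀, 0 < ‖y t - z t‖ :=
      Tendsto.eventually_const_lt (by simpa [sub_eq_zero] using h) ((hy.sub hz).norm t₀ ht₀)
    filter_upwards [Tendsto.eventually_lt_const (lt_add_one _) hd, hne] with t h1 h2
    exact ((div_lt_iff₀ h2).1 h1).le

end LocallyLipschitzInState

/-! ### Strongly continuous semigroups and their convolutions -/

namespace IsC0Semigroup

variable {H : Type*} [NormedAddCommGroup H] [NormedSpace ℝ H] {S : ℝ → H →L[ℝ] H}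

section Convolution

variable {T : ℝ} {h : ℝ → H}

theorem norm_integral_convolution_le {M : ℝ} (hM : ∀ t ∈ Icc 0 T, ‖S t‖ ≤ M)
    (hh : IntervalIntegrable h volume 0 T) {t : ℝ} (ht : t ∈ Icc 0 T) :
    ‖∫ s in (0 : ℝ)..t, S (t - s) (h s)‖ ≤ ∫ s in (0 : ℝ)..t, M * ‖h s‖ := by
  refine intervalIntegral.norm_integral_le_of_norm_le ht.1 (ae_of_all _ fun s hs => ?_)
    ((hh.mono_Icc ⟨le_rfl, ht.1.trans ht.2⟩ ht).norm.const_mul M)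
  exact (S _).le_of_opNorm_le (hM _ ⟨sub_nonneg.2 hs.2, by linarith [hs.1, ht.2]⟩) _

/-- A domain independent of t is what dominated convergence and Fubini require. The truncation at 0
keeps the semigroup at nonnegative times, the only ones where it is controlled. -/
theorem integral_convolution_eq {t : ℝ} (ht : t ∈ Icc 0 T) :
    ∫ s in (0 : ℝ)..t, S (t - s) (h s) =
      ∫ s in Ioc 0 T, (Iic t).indicator (fun s => S (max (t - s) 0) (h s)) s := by
  rw [intervalIntegral.integral_of_le ht.1, setIntegral_indicator measurableSet_Iic]
  have : Ioc 0 T ∩ Iic t = Ioc 0 t := by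
    ext s
    simp only [mem_inter_iff, mem_Ioc, mem_Iic]
    exact ⟨fun h => ⟨h.1.1, h.2⟩, fun h => ⟨⟨h.1, h.2.trans ht.2⟩, h.2⟩⟩
  rw [this]
  refine setIntegral_congr_fun measurableSet_Ioc fun s hs => ?_
  rw [max_eq_left (sub_nonneg.2 hs.2)]

end Convolution

variable [CompleteSpace H]

theorem exists_norm_le (hS : IsC0Semigroup S) (T : ℝ) :
    ∃ M : ℝ, 0 ≤ M ∧ ∀ t ∈ Icc 0 T, ‖S t‖ ≤ M := by
  obtain ⟨M, hM⟩ := banach_steinhaus (g := fun t : Icc 0 T => S t) fun x => by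
    obtain ⟨C, hC⟩ := isCompact_Icc.bddAbove_image
      ((hS.continuousOn x).mono (fun _ hr => mem_Ici.2 hr.1 : Icc 0 T ⊆ Ici 0)).norm
    exact ⟨C, fun t => hC (mem_image_of_mem _ t.2)⟩
  exact ⟨max M 0, le_max_right _ _, fun t ht => (hM ⟨t, ht⟩).trans (le_max_left _ _)⟩

/-- Strong continuity and local boundedness give joint continuity. This replaces norm continuity,
which may fail, in the measurability of s ↦ S(t - s) h(s). -/
theorem continuous_uncurry (hS : IsC0Semigroup S) :
    Continuous fun w : ℝ × H => S (max w.1 0) w.2 := by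
  rw [continuous_iff_continuousAt]
  rintro ⟨t₀, x₀⟩
  obtain ⟨M, -, hM⟩ := hS.exists_norm_le (max (t₀ + 1) 0)
  refine continuousAt_uncurry_of_eventually_norm_sub_le (g := fun t x => S (max t 0) x) M ?_ ?_
  · have : ∀ᶠ w : ℝ × H in 𝓝 (t₀, x₀), w.1 < t₀ + 1 :=
      (continuous_fst.tendsto (t₀, x₀)).eventually_lt_const (lt_add_one t₀)
    filter_upwards [this] with w hw
    rw [← map_sub]
    exact (S _).le_of_opNorm_le (hM _ ⟨le_max_right _ _, max_le_max_right _ hw.le⟩) _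
  · have : Continuous fun t => S (max t 0) x₀ :=
      (hS.continuousOn x₀).comp_continuous (by fun_prop) fun t => mem_Ici.2 (le_max_right _ _)
    exact this.continuousAt

section Convolution

variable {T : ℝ} {h : ℝ → H}

theorem aestronglyMeasurable_convolution (hS : IsC0Semigroup S) {μ : Measure ℝ}
    (hh : AEStronglyMeasurable h μ) (t : ℝ) :
    AEStronglyMeasurable (fun s => S (max (t - s) 0) (h s)) μ :=
  hS.continuous_uncurry.comp_aestronglyMeasurable
    ((Continuous.aestronglyMeasurable (by fun_prop : Continuous fun s => t - s)).prodMk hh)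

theorem intervalIntegrable_convolution (hS : IsC0Semigroup S)
    (hh : IntervalIntegrable h volume 0 T) {t : ℝ} (ht : t ∈ Icc 0 T) :
    IntervalIntegrable (fun s => S (t - s) (h s)) volume 0 t := by
  obtain ⟨M, -, hM⟩ := hS.exists_norm_le T
  have hh' := hh.mono_Icc ⟨le_rfl, ht.1.trans ht.2⟩ ht
  rw [intervalIntegrable_iff_integrableOn_Ioc_of_le ht.1] at hh' ⊢
  have hm := hS.aestronglyMeasurable_convolution hh'.1 t
  have heq : (fun s => S (max (t - s) 0) (h s)) =ᵐ[volume.restrict (Ioc 0 t)]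
      fun s => S (t - s) (h s) := by
    refine (ae_restrict_mem measurableSet_Ioc).mono fun s hs => ?_
    simp only
    rw [max_eq_left (sub_nonneg.2 hs.2)]
  refine (hh'.norm.const_mul M).mono' (hm.congr heq) ?_
  refine (ae_restrict_mem measurableSet_Ioc).mono fun s hs => ?_
  exact (S _).le_of_opNorm_le (hM _ ⟨sub_nonneg.2 hs.2, by linarith [hs.1, ht.2]⟩) _

theorem continuousOn_convolution (hS : IsC0Semigroup S)
    (hh : IntervalIntegrable h volume 0 T) :
    ContinuousOn (fun t => ∫ s in (0 : ℝ)..t, S (t - s) (h s)) (Icc 0 T) := by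
  rcases lt_or_ge T 0 with hT | hT
  · simp [Icc_eq_empty hT.not_ge]
  obtain ⟨M, hM0, hM⟩ := hS.exists_norm_le T
  refine ContinuousOn.congr (f := fun t =>
    ∫ s in Ioc 0 T, (Iic t).indicator (fun s => S (max (t - s) 0) (h s)) s) ?_
    fun t ht => integral_convolution_eq ht
  have hh' := hh
  rw [intervalIntegrable_iff_integrableOn_Ioc_of_le hT] at hh'
  intro t₀ ht₀
  refine continuousWithinAt_of_dominated (bound := fun s => M * ‖h s‖) ?_ ?_
    (hh'.norm.const_mul M) ?_
  · exact Eventually.of_forall fun t =>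
      (hS.aestronglyMeasurable_convolution hh'.1 t).indicator measurableSet_Iic
  · filter_upwards [self_mem_nhdsWithin] with t ht
    refine (ae_restrict_mem measurableSet_Ioc).mono fun s hs => ?_
    refine (norm_indicator_le_norm_self _ _).trans ?_
    exact (S _).le_of_opNorm_le (hM _ ⟨le_max_right _ _, max_le (by linarith [hs.1, ht.2]) hT⟩) _
  · have hne : ∀ᵐ s : ℝ ∂(volume.restrict (Ioc 0 T)), s ≠ t₀ := Measure.ae_ne _ _
    refine hne.mono fun s hs => ContinuousAt.continuousWithinAt ?_
    rcases lt_or_gt_of_ne hs with hs | hs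
    · have : ContinuousAt (fun t => S (max (t - s) 0) (h s)) t₀ :=
        (hS.continuous_uncurry.comp
          (by fun_prop : Continuous fun t : ℝ => (t - s, h s))).continuousAt
      refine this.congr ?_
      filter_upwards [lt_mem_nhds hs] with t ht
      rw [indicator_of_mem (by exact ht.le)]
    · refine (continuousAt_const (y := (0 : H))).congr ?_
      filter_upwards [gt_mem_nhds hs] with t ht
      rw [indicator_of_notMem (by simpa using ht)]

end Convolution

end IsC0Semigroup

/-! ### Mild solutions: uniqueness, and existence near the reference trajectory -/

namespace StageProblem

variable {H U : Type*} [NormedAddCommGroup H] [InnerProductSpace ℝ H]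
  [NormedAddCommGroup U] [InnerProductSpace ℝ U]

/-- The control operator extended to all times by its values at the ends of `[0, T]`. -/
def extendedF (Q : StageProblem H U) (t : ℝ) : H → U →L[ℝ] H := Q.f (max 0 (min t Q.T))

theorem extendedF_eq (Q : StageProblem H U) {t : ℝ} (ht : t ∈ Icc 0 Q.T) :
    Q.extendedF t = Q.f t := by
  rw [extendedF, min_eq_left ht.2, max_eq_right ht.1]

namespace Assumptions

variable {Q : StageProblem H U}

/-- The mean value inequality on a ball handles interior times; the times 0 and T follow by passing
to the limit in t, since f is continuous in time. -/
theorem locallyLipschitzInState_f (hQ : Q.Assumptions)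
    : LocallyLipschitzInState Q.f (Icc 0 Q.T) := by
  intro t₀ ht₀ z₀
  obtain ⟨δ, hδ, C, hC⟩ := hQ.f_deriv_locally_bounded t₀ ht₀ z₀
  have hIoo : ∀ t ∈ Ioo 0 Q.T, |t - t₀| < δ → ∀ z z' : H, ‖z - z₀‖ < δ → ‖z' - z₀‖ < δ →
      ‖Q.f t z - Q.f t z'‖ ≤ max C 0 * ‖z - z'‖ := by
    intro t ht htδ z z' hz hz'
    refine (convex_ball z₀ δ).norm_image_sub_le_of_norm_fderiv_le (𝕜 := ℝ)
      (fun x _ => (hQ.f_contDiff t ht).differentiable one_ne_zero x) (fun x hx => ?_)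
      (by rwa [mem_ball_iff_norm]) (by rwa [mem_ball_iff_norm])
    exact (hC t ht htδ x (by rwa [mem_ball_iff_norm] at hx)).trans (le_max_left _ _)
  refine ⟨δ, hδ, max C 0, le_max_right _ _, fun t ht htδ z z' hz hz' => ?_⟩
  have hcl : t ∈ closure (Ioo 0 Q.T) := by rwa [closure_Ioo hQ.T_pos.ne]
  have := mem_closure_iff_nhdsWithin_neBot.1 hcl
  have hlim : ∀ x, Tendsto (fun s => Q.f s x) (𝓝[Ioo 0 Q.T] t) (𝓝 (Q.f t x)) := fun x =>
    (hQ.f_continuous_time x t ht).mono_left (nhdsWithin_mono _ Ioo_subset_Icc_self)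
  refine le_of_tendsto ((hlim z).sub (hlim z')).norm ?_
  have hnear : ∀ᶠ s in 𝓝[Ioo 0 Q.T] t, |s - t₀| < δ :=
    nhdsWithin_le_nhds ((continuous_abs.comp (continuous_id.sub continuous_const)).continuousAt
      |>.eventually_lt_const htδ)
  filter_upwards [hnear, self_mem_nhdsWithin] with s hs hsI
  exact hIoo s hsI hs z z' hz hz'

theorem continuous_extendedF (hQ : Q.Assumptions)
    : Continuous fun w : ℝ × H => Q.extendedF w.1 w.2 := by
  have hmem : ∀ t : ℝ, max 0 (min t Q.T) ∈ Icc 0 Q.T := fun t =>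
    ⟨le_max_left _ _, max_le hQ.T_pos.le (min_le_right _ _)⟩
  have hcc : Continuous fun t : ℝ => max 0 (min t Q.T) := by fun_prop
  rw [continuous_iff_continuousAt]
  rintro ⟨t₀, z₀⟩
  obtain ⟨δ, hδ, C, -, hC⟩ := hQ.locallyLipschitzInState_f _ (hmem t₀) z₀
  refine continuousAt_uncurry_of_eventually_norm_sub_le (g := Q.extendedF) C ?_ ?_
  · have h1 : ∀ᶠ w : ℝ × H in 𝓝 (t₀, z₀), |max 0 (min w.1 Q.T) - max 0 (min t₀ Q.T)| < δ := by
      have : Continuous fun w : ℝ × H => |max 0 (min w.1 Q.T) - max 0 (min t₀ Q.T)| := by fun_prop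
      exact this.continuousAt.eventually_lt_const (by simpa using hδ)
    have h2 : ∀ᶠ w : ℝ × H in 𝓝 (t₀, z₀), ‖w.2 - z₀‖ < δ := by
      have : Continuous fun w : ℝ × H => ‖w.2 - z₀‖ := by fun_prop
      exact this.continuousAt.eventually_lt_const (by simpa using hδ)
    filter_upwards [h1, h2] with w h1 h2
    exact hC _ (hmem _) h1 _ _ h2 (by simpa using hδ)
  · exact ((hQ.f_continuous_time z₀).comp_continuous hcc hmem).continuousAt

theorem continuousOn_f (hQ : Q.Assumptions) {z : ℝ → H} (hz : ContinuousOn z (Icc 0 Q.T)) :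
    ContinuousOn (fun t => Q.f t (z t)) (Icc 0 Q.T) := by
  refine (hQ.continuous_extendedF.comp_continuousOn (continuousOn_id.prodMk hz)).congr
    fun t ht => ?_
  simp [Q.extendedF_eq ht]

theorem exists_norm_f_le (hQ : Q.Assumptions) {z : ℝ → H} (hz : ContinuousOn z (Icc 0 Q.T)) :
    ∃ C : ℝ, 0 ≤ C ∧ ∀ t ∈ Icc 0 Q.T, ‖Q.f t (z t)‖ ≤ C := by
  obtain ⟨C, hC⟩ := isCompact_Icc.bddAbove_image (hQ.continuousOn_f hz).norm
  exact ⟨max C 0, le_max_right _ _, fun t ht => (hC (mem_image_of_mem _ ht)).trans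
    (le_max_left _ _)⟩

theorem aestronglyMeasurable_input (hQ : Q.Assumptions)
    {z : ℝ → H} (hz : ContinuousOn z (Icc 0 Q.T)) {u : ℝ → U}
    (hu : AEStronglyMeasurable u (volume.restrict (Ioc 0 Q.T))) :
    AEStronglyMeasurable (fun s => Q.f s (z s) (u s)) (volume.restrict (Ioc 0 Q.T)) :=
  (isBoundedBilinearMap_apply (𝕜 := ℝ) (E := U) (F := H)).continuous.comp_aestronglyMeasurable
    ((((hQ.continuousOn_f hz).mono Ioc_subset_Icc_self).aestronglyMeasurable
      measurableSet_Ioc).prodMk hu)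

theorem intervalIntegrable_input (hQ : Q.Assumptions)
    {z : ℝ → H} (hz : ContinuousOn z (Icc 0 Q.T)) {u : ℝ → U}
    (hu : IntervalIntegrable u volume 0 Q.T) :
    IntervalIntegrable (fun s => Q.f s (z s) (u s)) volume 0 Q.T := by
  obtain ⟨C, -, hC⟩ := hQ.exists_norm_f_le hz
  rw [intervalIntegrable_iff_integrableOn_Ioc_of_le hQ.T_pos.le] at hu ⊢
  refine (hu.norm.const_mul C).mono' (hQ.aestronglyMeasurable_input hz hu.1) ?_
  exact (ae_restrict_mem measurableSet_Ioc).mono fun s hs =>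
    (Q.f s (z s)).le_of_opNorm_le (hC s (Ioc_subset_Icc_self hs)) _

variable [CompleteSpace H]

theorem isMildSolution_of_eqOn (hQ : Q.Assumptions)
    {u : ℝ → U} (hu : IntervalIntegrable u volume 0 Q.T) {z : ℝ → H}
    (hz : ContinuousOn z (Icc 0 Q.T))
    (h : ∀ t ∈ Icc 0 Q.T,
      z t = Q.S t Q.y₀ + ∫ s in (0 : ℝ)..t, Q.S (t - s) (Q.f s (z s) (u s))) :
    Q.IsMildSolution u z :=
  ⟨hz, fun _ ht => hQ.semigroup.intervalIntegrable_convolution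
    (hQ.intervalIntegrable_input hz hu) ht, h⟩

/-- The common estimate behind uniqueness, the Picard contraction and the initial Picard defect. -/
theorem norm_convolution_sub_le (hQ : Q.Assumptions) {M : ℝ} (hM : ∀ t ∈ Icc 0 Q.T, ‖Q.S t‖ ≤ M)
    {u u' : ℝ → U} (hu : IntervalIntegrable u volume 0 Q.T)
    (hu' : IntervalIntegrable u' volume 0 Q.T) {z z' : ℝ → H}
    (hz : ContinuousOn z (Icc 0 Q.T)) (hz' : ContinuousOn z' (Icc 0 Q.T)) {φ : ℝ → ℝ}
    (hφi : IntervalIntegrable φ volume 0 Q.T)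
    (hφ : ∀ t ∈ Ioo 0 Q.T, M * ‖Q.f t (z t) (u t) - Q.f t (z' t) (u' t)‖ ≤ φ t)
    {t : ℝ} (ht : t ∈ Icc 0 Q.T) :
    ‖(∫ s in (0 : ℝ)..t, Q.S (t - s) (Q.f s (z s) (u s))) -
      ∫ s in (0 : ℝ)..t, Q.S (t - s) (Q.f s (z' s) (u' s))‖ ≤ ∫ s in (0 : ℝ)..t, φ s := by
  have hi := hQ.intervalIntegrable_input hz hu
  have hi' := hQ.intervalIntegrable_input hz' hu'
  have h0 : (0 : ℝ) ∈ Icc 0 Q.T := ⟨le_rfl, hQ.T_pos.le⟩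
  rw [← intervalIntegral.integral_sub (hQ.semigroup.intervalIntegrable_convolution hi ht)
    (hQ.semigroup.intervalIntegrable_convolution hi' ht)]
  simp only [← map_sub]
  refine (IsC0Semigroup.norm_integral_convolution_le
    (h := fun s => Q.f s (z s) (u s) - Q.f s (z' s) (u' s)) hM (hi.sub hi') ht).trans ?_
  refine intervalIntegral.integral_mono_on_of_le_Ioo ht.1
    (((hi.sub hi').norm.const_mul M).mono_Icc h0 ht) (hφi.mono_Icc h0 ht) fun s hs => ?_
  exact hφ s ⟨hs.1, hs.2.trans_le ht.2⟩

/-- Mild solutions for a control that is dominated by a function that is continuous on `(0, T)` are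
unique. -/
theorem isMildSolution_unique (hQ : Q.Assumptions)
    {u : ℝ → U} (hu : IntervalIntegrable u volume 0 Q.T)
    {κ : ℝ → ℝ} (hκ : ContinuousOn κ (Ioo 0 Q.T)) (hκi : IntervalIntegrable κ volume 0 Q.T)
    (huκ : ∀ t, ‖u t‖ ≤ κ t) {y z : ℝ → H} (hy : Q.IsMildSolution u y)
    (hz : Q.IsMildSolution u z) : EqOn z y (Icc 0 Q.T) := by
  obtain ⟨M, hM0, hM⟩ := hQ.semigroup.exists_norm_le Q.T
  obtain ⟨C, hC0, hC⟩ := hQ.locallyLipschitzInState_f.exists_const isCompact_Icc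
    (fun _ h => hQ.continuousOn_f h) hz.continuousOn hy.continuousOn
  have hκ0 : ∀ t, 0 ≤ κ t := fun t => (norm_nonneg _).trans (huκ t)
  have hk0 : ∀ t, 0 ≤ M * C * κ t := fun t => mul_nonneg (mul_nonneg hM0 hC0) (hκ0 t)
  have hd : ContinuousOn (fun t => ‖z t - y t‖) (Icc 0 Q.T) :=
    (hz.continuousOn.sub hy.continuousOn).norm
  have hki : IntervalIntegrable (fun t => M * C * κ t) volume 0 Q.T := hκi.const_mul _
  have hnp := nonpos_of_le_integral_mul hQ.T_pos.le (k := fun t => M * C * κ t)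
    (hκ.const_smul (M * C)) hk0 hki hd fun t ht => by
      rw [hz.eq t ht, hy.eq t ht, add_sub_add_left_eq_sub]
      refine hQ.norm_convolution_sub_le hM hu hu hz.continuousOn hy.continuousOn
        (hki.mul_continuousOn (by rwa [uIcc_of_le hQ.T_pos.le])) (fun s hs => ?_) ht
      rw [← sub_apply]
      calc M * ‖(Q.f s (z s) - Q.f s (y s)) (u s)‖
          ≤ M * ((C * ‖z s - y s‖) * κ s) := by
            refine mul_le_mul_of_nonneg_left ?_ hM0
            exact ((Q.f s (z s) - Q.f s (y s)).le_opNorm _).trans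
              (mul_le_mul (hC s (Ioo_subset_Icc_self hs)) (huκ s) (norm_nonneg _)
                (mul_nonneg hC0 (norm_nonneg _)))
        _ = M * C * κ s * ‖z s - y s‖ := by ring
  intro t ht
  have := le_antisymm (hnp t ht) (norm_nonneg _)
  rwa [norm_eq_zero, sub_eq_zero] at this

/-- Solvability near a reference trajectory: controls that are close to the reference control in
`L¹` have mild solutions, which depend on them in a Lipschitz way. -/
theorem exists_isMildSolution_near (hQ : Q.Assumptions)
    {u₁ : ℝ → U} (hu₁ : IntervalIntegrable u₁ volume 0 Q.T)
    {κ : ℝ → ℝ} (hκ : ContinuousOn κ (Ioo 0 Q.T)) (hκ0 : ∀ t, 0 ≤ κ t)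
    (hκi : IntervalIntegrable κ volume 0 Q.T) {y : ℝ → H} (hy : Q.IsMildSolution u₁ y) :
    ∃ L : ℝ, 0 ≤ L ∧ ∃ η > 0, ∀ u : ℝ → U, IntervalIntegrable u volume 0 Q.T →
      (∀ t, ‖u t‖ ≤ κ t) → (∫ s in (0 : ℝ)..Q.T, ‖u s - u₁ s‖) ≤ η →
      ∃ z, Q.IsMildSolution u z ∧ ∀ t ∈ Icc 0 Q.T,
        ‖z t - y t‖ ≤ L * ∫ s in (0 : ℝ)..Q.T, ‖u s - u₁ s‖ := by
  obtain ⟨M, hM0, hM⟩ := hQ.semigroup.exists_norm_le Q.T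
  obtain ⟨δ', hδ', C, hC0, hC⟩ := hQ.locallyLipschitzInState_f.exists_tube isCompact_Icc
    hy.continuousOn
  obtain ⟨D, hD0, hD⟩ := hQ.exists_norm_f_le hy.continuousOn
  have hk0 : ∀ t, 0 ≤ M * C * κ t := fun t => mul_nonneg (mul_nonneg hM0 hC0) (hκ0 t)
  have hki : IntervalIntegrable (fun t => M * C * κ t) volume 0 Q.T := hκi.const_mul _
  set E : ℝ := Real.exp (∫ s in (0 : ℝ)..Q.T, M * C * κ s) with hE
  have hE0 : 0 < E := Real.exp_pos _
  -- With I the L¹ distance of the controls, inserting y into the fixed-point map leaves a defect of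
  -- at most M·D·I, which the iteration amplifies by at most E. The bound on I keeps M·D·E·I below
  -- δ'; the +1 guards against a zero denominator.
  refine ⟨M * D * E, by positivity, δ' / (M * D * E + 1), by positivity, fun u hu huκ hη => ?_⟩
  set I := ∫ s in (0 : ℝ)..Q.T, ‖u s - u₁ s‖ with hI
  have hI0 : 0 ≤ I := intervalIntegral.integral_nonneg hQ.T_pos.le fun _ _ => norm_nonneg _
  have hδI : M * D * I * E ≤ δ' := by
    rw [le_div_iff₀ (by positivity)] at hη
    nlinarith
  have hsubi : IntervalIntegrable (fun s => M * D * ‖u s - u₁ s‖) volume 0 Q.T :=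
    (hu.sub hu₁).norm.const_mul _
  set Φ : (ℝ → H) → ℝ → H := fun z t =>
    Q.S t Q.y₀ + ∫ s in (0 : ℝ)..t, Q.S (t - s) (Q.f s (z s) (u s)) with hΦdef
  have hΦ : ∀ z, ContinuousOn z (Icc 0 Q.T) → ContinuousOn (Φ z) (Icc 0 Q.T) := by
    intro z hz
    exact ((hQ.semigroup.continuousOn _).mono fun _ h => h.1).add
      (hQ.semigroup.continuousOn_convolution (hQ.intervalIntegrable_input hz hu))
  have hlip : ∀ z z', ContinuousOn z (Icc 0 Q.T) → ContinuousOn z' (Icc 0 Q.T) →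
      (∀ s ∈ Icc 0 Q.T, ‖z s - y s‖ ≤ δ') → (∀ s ∈ Icc 0 Q.T, ‖z' s - y s‖ ≤ δ') →
      ∀ t ∈ Icc 0 Q.T, ‖Φ z t - Φ z' t‖ ≤ ∫ s in (0 : ℝ)..t, M * C * κ s * ‖z s - z' s‖ := by
    intro z z' hz hz' hzδ hzδ' t ht
    simp only [hΦdef, add_sub_add_left_eq_sub]
    refine hQ.norm_convolution_sub_le hM hu hu hz hz' (hki.mul_continuousOn
      (by rw [uIcc_of_le hQ.T_pos.le]; exact (hz.sub hz').norm)) (fun s hs => ?_) ht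
    have hs' := Ioo_subset_Icc_self hs
    rw [← sub_apply]
    calc M * ‖(Q.f s (z s) - Q.f s (z' s)) (u s)‖
        ≤ M * ((C * ‖z s - z' s‖) * κ s) := by
          refine mul_le_mul_of_nonneg_left ?_ hM0
          exact ((Q.f s (z s) - Q.f s (z' s)).le_opNorm _).trans
            (mul_le_mul (hC s hs' _ _ (hzδ s hs') (hzδ' s hs')) (huκ s) (norm_nonneg _)
              (mul_nonneg hC0 (norm_nonneg _)))
      _ = M * C * κ s * ‖z s - z' s‖ := by ring
  have hya : ∀ t ∈ Icc 0 Q.T, ‖Φ y t - y t‖ ≤ M * D * I := by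
    intro t ht
    have h1 : ‖(∫ s in (0 : ℝ)..t, Q.S (t - s) (Q.f s (y s) (u s))) -
        ∫ s in (0 : ℝ)..t, Q.S (t - s) (Q.f s (y s) (u₁ s))‖ ≤
        ∫ s in (0 : ℝ)..t, M * D * ‖u s - u₁ s‖ := by
      refine hQ.norm_convolution_sub_le hM hu hu₁ hy.continuousOn hy.continuousOn hsubi
        (fun s hs => ?_) ht
      rw [← map_sub, mul_assoc]
      exact mul_le_mul_of_nonneg_left ((Q.f s (y s)).le_of_opNorm_le
        (hD s (Ioo_subset_Icc_self hs)) _) hM0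
    have h2 := primitive_mono (k := fun s => M * D * ‖u s - u₁ s‖) (fun s => by positivity)
      hsubi ht
    rw [intervalIntegral.integral_const_mul (a := 0) (b := Q.T)] at h2
    rw [hΦdef, hy.eq t ht, add_sub_add_left_eq_sub]
    exact h1.trans h2
  obtain ⟨z, hzc, hzy, hz⟩ := exists_fixedPoint_in_tube (T := Q.T) (k := fun t => M * C * κ t)
    (y := y) (Φ := Φ) (δ := δ') (a := M * D * I) hQ.T_pos.le (hκ.const_smul (M * C)) hk0 hki
    (by positivity) hy.continuousOn hΦ hlip hya hδI
  refine ⟨z, hQ.isMildSolution_of_eqOn hu hzc hz, fun t ht => (hzy t ht).trans_eq ?_⟩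
  rw [← hE]; ring

end Assumptions

end StageProblem

/-! ### The Hamiltonian and the duality with the adjoint equation -/

namespace StageProblem

variable {H U : Type*} [NormedAddCommGroup H] [InnerProductSpace ℝ H]
  [NormedAddCommGroup U] [InnerProductSpace ℝ U]

/-- The Hamiltonian of the stage problem along a control and an adjoint state. -/
def hamiltonian (Q : StageProblem H U) (u : ℝ → U) (p : ℝ → H →L[ℝ] ℝ) (s : ℝ) (x : H) : ℝ :=
  Q.l₁ x + p s (Q.f s x (u s))

namespace Assumptions

variable {Q : StageProblem H U}

/-- The source of the adjoint equation is the state derivative of the Hamiltonian, so the errors in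
l₁ and in the dynamics combine into one Taylor remainder. -/
theorem hasFDerivAt_hamiltonian (hQ : Q.Assumptions) (u : ℝ → U) (y : ℝ → H)
    (p : ℝ → H →L[ℝ] ℝ) {s : ℝ} (hs : s ∈ Ioo 0 Q.T) :
    HasFDerivAt (Q.hamiltonian u p s) (Q.adjointSource u y p s) (y s) := by
  have h1 : HasFDerivAt Q.l₁ (fderiv ℝ Q.l₁ (y s)) (y s) :=
    (hQ.l₁_contDiff.differentiable one_ne_zero _).hasFDerivAt
  have h2 : HasFDerivAt (fun z => Q.f s z (u s)) (fderiv ℝ (fun z => Q.f s z (u s)) (y s)) (y s) :=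
    (((hQ.f_contDiff s hs).differentiable one_ne_zero).clm_apply
      (differentiable_const _) _).hasFDerivAt
  rw [adjointSource, add_comm]
  exact h1.add ((p s).hasFDerivAt.comp (y s) h2)

/-- The integrable `B` dominates both the increments of the Hamiltonian and its derivative; it
supplies the majorants for Fubini and for dominated convergence. -/
theorem exists_hamiltonian_tube (hQ : Q.Assumptions) {u : ℝ → U}
    (hu : IntervalIntegrable u volume 0 Q.T) {y : ℝ → H} (hy : ContinuousOn y (Icc 0 Q.T))
    {p : ℝ → H →L[ℝ] ℝ} (hp : ContinuousOn p (Icc 0 Q.T)) :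
    ∃ δ > 0, ∃ B : ℝ → ℝ, IntervalIntegrable B volume 0 Q.T ∧
      (∀ s ∈ Ioo 0 Q.T, ∀ x x' : H, ‖x - y s‖ ≤ δ → ‖x' - y s‖ ≤ δ →
        ‖Q.hamiltonian u p s x - Q.hamiltonian u p s x'‖ ≤ B s * ‖x - x'‖) ∧
      ∀ s ∈ Ioo 0 Q.T, 0 ≤ B s ∧ ‖Q.adjointSource u y p s‖ ≤ B s := by
  obtain ⟨δ₁, hδ₁, C₁, hC₁, h₁⟩ := hQ.locallyLipschitzInState_f.exists_tube isCompact_Icc hy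
  obtain ⟨δ₂, hδ₂, C₂, hC₂, h₂⟩ := (LocallyLipschitzInState.of_contDiff
    (s := Icc 0 Q.T) hQ.l₁_contDiff).exists_tube isCompact_Icc hy
  obtain ⟨P, hP⟩ := isCompact_Icc.bddAbove_image hp.norm
  have hP' : ∀ s ∈ Icc 0 Q.T, ‖p s‖ ≤ max P 0 := fun s hs =>
    (hP (mem_image_of_mem _ hs)).trans (le_max_left _ _)
  have hP0 : 0 ≤ max P 0 := le_max_right _ _
  have hlip : ∀ s ∈ Ioo 0 Q.T, ∀ x x' : H, ‖x - y s‖ ≤ min δ₁ δ₂ → ‖x' - y s‖ ≤ min δ₁ δ₂ →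
      ‖Q.hamiltonian u p s x - Q.hamiltonian u p s x'‖ ≤
        (C₂ + max P 0 * C₁ * ‖u s‖) * ‖x - x'‖ := by
    intro s hs x x' hx hx'
    have hs' := Ioo_subset_Icc_self hs
    have e : Q.hamiltonian u p s x - Q.hamiltonian u p s x' =
        (Q.l₁ x - Q.l₁ x') + p s ((Q.f s x - Q.f s x') (u s)) := by
      simp only [hamiltonian, sub_apply, map_sub]; ring
    have i1 := h₂ s hs' x x' (hx.trans (min_le_right _ _)) (hx'.trans (min_le_right _ _))
    have i2 := h₁ s hs' x x' (hx.trans (min_le_left _ _)) (hx'.trans (min_le_left _ _))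
    have i3 : ‖p s ((Q.f s x - Q.f s x') (u s))‖ ≤ max P 0 * ((C₁ * ‖x - x'‖) * ‖u s‖) :=
      (p s).le_of_opNorm_le_of_le (hP' s hs') ((Q.f s x - Q.f s x').le_of_opNorm_le i2 _)
    rw [e]
    refine (norm_add_le _ _).trans ((add_le_add i1 i3).trans_eq ?_)
    ring
  have hB : ∀ s, 0 ≤ C₂ + max P 0 * C₁ * ‖u s‖ := fun s => by positivity
  refine ⟨min δ₁ δ₂, lt_min hδ₁ hδ₂, fun s => C₂ + max P 0 * C₁ * ‖u s‖,
    intervalIntegrable_const.add (hu.norm.const_mul _), hlip, fun s hs => ⟨hB s, ?_⟩⟩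
  refine (hQ.hasFDerivAt_hamiltonian u y p hs).le_of_lip' (hB s) ?_
  have : Metric.closedBall (y s) (min δ₁ δ₂) ∈ 𝓝 (y s) :=
    Metric.closedBall_mem_nhds _ (lt_min hδ₁ hδ₂)
  filter_upwards [this] with x hx
  exact hlip s hs x (y s) (by rwa [mem_closedBall_iff_norm] at hx)
    (by simpa using ⟨hδ₁.le, hδ₂.le⟩)

theorem ae_mem_Ioo_of_restrict_Ioc {a b : ℝ} :
    ∀ᵐ s ∂(volume.restrict (Ioc a b)), s ∈ Ioo a b := by
  rw [← restrict_Ioo_eq_restrict_Ioc]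
  exact ae_restrict_mem measurableSet_Ioo

section Measurability

variable {α : Type*} [MeasurableSpace α] {ν : Measure α} {σ : α → ℝ}

/-- The map σ is the identity for single integrals and the first projection for the double integral
in the duality. -/
theorem aestronglyMeasurable_hamiltonian (hQ : Q.Assumptions)
    (hσ : Measure.QuasiMeasurePreserving σ ν (volume.restrict (Ioc 0 Q.T))) {u : ℝ → U}
    (hu : AEStronglyMeasurable u (volume.restrict (Ioc 0 Q.T)))
    {p : ℝ → H →L[ℝ] ℝ} (hp : ContinuousOn p (Icc 0 Q.T)) {X : α → H}
    (hX : AEStronglyMeasurable X ν) :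
    AEStronglyMeasurable (fun a => Q.hamiltonian u p (σ a) (X a)) ν := by
  have h1 : AEStronglyMeasurable (fun a => Q.l₁ (X a)) ν :=
    hQ.l₁_contDiff.continuous.comp_aestronglyMeasurable hX
  have h2 : AEStronglyMeasurable (fun a => Q.extendedF (σ a) (X a)) ν :=
    hQ.continuous_extendedF.comp_aestronglyMeasurable
      (hσ.measurable.aestronglyMeasurable.prodMk hX)
  have h3 : AEStronglyMeasurable (fun a => Q.extendedF (σ a) (X a) (u (σ a))) ν :=
    (isBoundedBilinearMap_apply (𝕜 := ℝ) (E := U) (F := H)).continuous.comp_aestronglyMeasurable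
      (h2.prodMk (hu.comp_quasiMeasurePreserving hσ))
  have hp' : AEStronglyMeasurable p (volume.restrict (Ioc 0 Q.T)) :=
    (hp.mono Ioc_subset_Icc_self).aestronglyMeasurable measurableSet_Ioc
  have h4 : AEStronglyMeasurable (fun a => p (σ a) (Q.extendedF (σ a) (X a) (u (σ a)))) ν :=
    (isBoundedBilinearMap_apply (𝕜 := ℝ) (E := H) (F := ℝ)).continuous.comp_aestronglyMeasurable
      ((hp'.comp_quasiMeasurePreserving hσ).prodMk h3)
  refine (h1.add h4).congr ?_
  filter_upwards [hσ.ae (ae_restrict_mem measurableSet_Ioc)] with a ha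
  simp [hamiltonian, Q.extendedF_eq (Ioc_subset_Icc_self ha)]

/-- The derivative of f is not assumed measurable in time. Applied to a vector, it is an almost
everywhere limit of difference quotients of the Hamiltonian, which are measurable. -/
theorem aestronglyMeasurable_adjointSource_apply (hQ : Q.Assumptions)
    (hσ : Measure.QuasiMeasurePreserving σ ν (volume.restrict (Ioc 0 Q.T))) {u : ℝ → U}
    (hu : AEStronglyMeasurable u (volume.restrict (Ioc 0 Q.T)))
    {y : ℝ → H} (hy : ContinuousOn y (Icc 0 Q.T))
    {p : ℝ → H →L[ℝ] ℝ} (hp : ContinuousOn p (Icc 0 Q.T)) {X : α → H}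
    (hX : AEStronglyMeasurable X ν) :
    AEStronglyMeasurable (fun a => Q.adjointSource u y p (σ a) (X a)) ν := by
  have hy' : AEStronglyMeasurable (fun a => y (σ a)) ν :=
    ((hy.mono Ioc_subset_Icc_self).aestronglyMeasurable
      measurableSet_Ioc).comp_quasiMeasurePreserving hσ
  refine aestronglyMeasurable_of_tendsto_ae atTop
    (f := fun (n : ℕ) a => (n : ℝ) • (Q.hamiltonian u p (σ a) (y (σ a) + (n : ℝ)⁻¹ • X a) -
      Q.hamiltonian u p (σ a) (y (σ a)))) (fun n => ?_) ?_
  · exact ((hQ.aestronglyMeasurable_hamiltonian hσ hu hp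
      (hy'.add (hX.const_smul ((n : ℝ)⁻¹)))).sub
        (hQ.aestronglyMeasurable_hamiltonian hσ hu hp hy')).const_smul (n : ℝ)
  · filter_upwards [hσ.ae ae_mem_Ioo_of_restrict_Ioc] with a ha
    refine (hQ.hasFDerivAt_hamiltonian u y p ha).lim (X a) (c := fun n : ℕ => (n : ℝ)) ?_
    simpa using tendsto_natCast_atTop_atTop (R := ℝ)

end Measurability

variable [CompleteSpace H]

/-- The duality between the convolution with the semigroup and the adjoint equation. -/
theorem integral_adjoint_apply (hQ : Q.Assumptions) {u : ℝ → U}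
    (hu : IntervalIntegrable u volume 0 Q.T) {y : ℝ → H} (hy : ContinuousOn y (Icc 0 Q.T))
    {p : ℝ → H →L[ℝ] ℝ} (hp : Q.IsMildAdjoint u y p) {F : ℝ → H}
    (hF : IntervalIntegrable F volume 0 Q.T) :
    ∫ t in (0 : ℝ)..Q.T, p t (F t) =
      p Q.T (∫ s in (0 : ℝ)..Q.T, Q.S (Q.T - s) (F s)) +
        ∫ s in (0 : ℝ)..Q.T, Q.adjointSource u y p s (∫ r in (0 : ℝ)..s, Q.S (s - r) (F r)) := by
  have hT := hQ.T_pos.le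
  have hTT : Q.T ∈ Icc 0 Q.T := ⟨hT, le_rfl⟩
  obtain ⟨M, hM0, hM⟩ := hQ.semigroup.exists_norm_le Q.T
  obtain ⟨-, -, B, hB, -, hqB⟩ := hQ.exists_hamiltonian_tube hu hy hp.continuousOn
  have hB' := hB
  have hF' := hF
  have hu' := hu
  rw [intervalIntegrable_iff_integrableOn_Ioc_of_le hT] at hB' hF' hu'
  set μ : Measure ℝ := volume.restrict (Ioc 0 Q.T) with hμ
  set X : ℝ → ℝ → H := fun s t => (Iic s).indicator (fun t => Q.S (max (s - t) 0) (F t)) t with hX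
  have hXnorm : ∀ s ∈ Ioc 0 Q.T, ∀ t ∈ Ioc 0 Q.T, ‖X s t‖ ≤ M * ‖F t‖ := by
    intro s hs t ht
    refine (norm_indicator_le_norm_self _ _).trans ?_
    exact (Q.S _).le_of_opNorm_le
      (hM _ ⟨le_max_right _ _, max_le (by linarith [hs.2, ht.1]) hT⟩) _
  have hXm : AEStronglyMeasurable (fun w : ℝ × ℝ => X w.1 w.2) (μ.prod μ) := by
    have h1 : AEStronglyMeasurable (fun w : ℝ × ℝ => Q.S (max (w.1 - w.2) 0) (F w.2))
        (μ.prod μ) :=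
      hQ.semigroup.continuous_uncurry.comp_aestronglyMeasurable
        ((by fun_prop : Continuous fun w : ℝ × ℝ => w.1 - w.2).aestronglyMeasurable.prodMk
          hF'.1.comp_snd)
    exact h1.indicator (s := {w : ℝ × ℝ | w.2 ≤ w.1})
      (measurableSet_le measurable_snd measurable_fst)
  have hΨm : AEStronglyMeasurable (fun w : ℝ × ℝ => Q.adjointSource u y p w.1 (X w.1 w.2))
      (μ.prod μ) :=
    hQ.aestronglyMeasurable_adjointSource_apply Measure.quasiMeasurePreserving_fst hu'.1 hy
      hp.continuousOn hXm
  have hΨ : Integrable (Function.uncurry fun s t => Q.adjointSource u y p s (X s t))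
      (μ.prod μ) := by
    refine Integrable.mono' (hB'.mul_prod (hF'.norm.const_mul M)) hΨm ?_
    filter_upwards [Measure.quasiMeasurePreserving_fst.ae
      (ae_mem_Ioo_of_restrict_Ioc (a := 0) (b := Q.T)), Measure.quasiMeasurePreserving_snd.ae
      (ae_mem_Ioo_of_restrict_Ioc (a := 0) (b := Q.T))] with w h1 h2
    exact (Q.adjointSource u y p w.1).le_of_opNorm_le_of_le (hqB _ h1).2
      (hXnorm _ (Ioo_subset_Ioc_self h1) _ (Ioo_subset_Ioc_self h2))
  -- On the triangle t ≤ s, integrating first in t gives the convolution up to time s; integrating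
  -- first in s gives the integral term of the adjoint equation at time t, applied to F(t).
  have hswap := integral_integral_swap hΨ
  have hleft : ∫ s in (0 : ℝ)..Q.T,
      Q.adjointSource u y p s (∫ r in (0 : ℝ)..s, Q.S (s - r) (F r)) =
      ∫ s, ∫ t, Q.adjointSource u y p s (X s t) ∂μ ∂μ := by
    rw [intervalIntegral.integral_of_le hT]
    refine setIntegral_congr_fun measurableSet_Ioc fun s hs => ?_
    have hXs : Integrable (X s) μ := by
      refine (hF'.norm.const_mul M).mono'
        ((hQ.semigroup.aestronglyMeasurable_convolution hF'.1 s).indicator measurableSet_Iic) ?_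
      exact (ae_restrict_mem measurableSet_Ioc).mono fun t ht => hXnorm s hs t ht
    rw [(Q.adjointSource u y p s).integral_comp_comm hXs,
      IsC0Semigroup.integral_convolution_eq (Ioc_subset_Icc_self hs)]
  have hright : ∀ t ∈ Ioc 0 Q.T, ∫ s, Q.adjointSource u y p s (X s t) ∂μ =
      p t (F t) - p Q.T (Q.S (Q.T - t) (F t)) := by
    intro t ht
    have ht' := Ioc_subset_Icc_self ht
    have h1 : ∀ s, Q.adjointSource u y p s (X s t) =
        (Ici t).indicator (fun s => Q.adjointSource u y p s (Q.S (s - t) (F t))) s := by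
      intro s
      by_cases hst : t ≤ s
      · rw [hX]
        simp only
        rw [indicator_of_mem (by exact hst), indicator_of_mem (by exact hst),
          max_eq_left (sub_nonneg.2 hst)]
      · rw [hX]
        simp only
        rw [indicator_of_notMem (by exact hst), indicator_of_notMem (by exact hst), map_zero]
    have hset : Ioc 0 Q.T ∩ Ici t = Icc t Q.T := by
      ext s
      simp only [mem_inter_iff, mem_Ioc, mem_Ici, mem_Icc]
      exact ⟨fun h => ⟨h.2, h.1.2⟩, fun h => ⟨⟨ht.1.trans_le h.1, h.2⟩, h.1⟩⟩
    have h2 := hp.eq t ht'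
    have h3 : p t (F t) - p Q.T (Q.S (Q.T - t) (F t)) =
        (∫ s in t..Q.T, (Q.adjointSource u y p s).comp (Q.S (s - t))) (F t) := by
      conv_lhs => rw [h2]
      simp
    rw [h3, ContinuousLinearMap.intervalIntegral_apply (hp.integrable t ht'),
      intervalIntegral.integral_of_le ht.2]
    simp_rw [h1]
    rw [hμ, setIntegral_indicator measurableSet_Ici, hset, integral_Icc_eq_integral_Ioc]
    rfl
  have hpF : IntegrableOn (fun t => p t (F t)) (Ioc 0 Q.T) := by
    obtain ⟨P, hP⟩ := isCompact_Icc.bddAbove_image hp.continuousOn.norm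
    refine (hF'.norm.const_mul P).mono'
      ((isBoundedBilinearMap_apply (𝕜 := ℝ) (E := H)
        (F := ℝ)).continuous.comp_aestronglyMeasurable
        (((hp.continuousOn.mono Ioc_subset_Icc_self).aestronglyMeasurable
          measurableSet_Ioc).prodMk hF'.1)) ?_
    exact (ae_restrict_mem measurableSet_Ioc).mono fun t ht =>
      (p t).le_of_opNorm_le (hP (mem_image_of_mem _ (Ioc_subset_Icc_self ht))) _
  have hSF := hQ.semigroup.intervalIntegrable_convolution hF hTT
  rw [intervalIntegrable_iff_integrableOn_Ioc_of_le hT] at hSF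
  rw [hleft, hswap, setIntegral_congr_fun measurableSet_Ioc hright,
    integral_sub hpF ((p Q.T).integrable_comp hSF), (p Q.T).integral_comp_comm hSF,
    intervalIntegral.integral_of_le hT, intervalIntegral.integral_of_le hT]
  ring

end Assumptions

end StageProblem

/-! ### First-order remainders, needle variations and the exact cost increment -/

theorem HasFDerivAt.tendsto_remainder_div {X ι : Type*} [NormedAddCommGroup X] [NormedSpace ℝ X]
    {g : X → ℝ} {g' : X →L[ℝ] ℝ} {y : X} (hg : HasFDerivAt g g' y) {l : Filter ι} {lam : ι → ℝ}
    (hlam : Tendsto lam l (𝓝 0)) {x : ι → X} {K : ℝ} (hx : ∀ᶠ i in l, ‖x i - y‖ ≤ K * ‖lam i‖) :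
    Tendsto (fun i => (g (x i) - g y - g' (x i - y)) / lam i) l (𝓝 0) := by
  have hO : (fun i => x i - y) =O[l] lam := Asymptotics.IsBigO.of_bound K hx
  have hx0 : Tendsto x l (𝓝 y) := by
    have := (hO.trans_tendsto hlam).add_const y
    simpa using this
  exact ((hg.isLittleO.comp_tendsto hx0).trans_isBigO hO).tendsto_div_nhds_zero

namespace StageProblem

section Needle

variable {U : Type*} [NormedAddCommGroup U]

theorem needle_sub_apply (u₁ : ℝ → U) (lam τ : ℝ) (v : U) (s : ℝ) :
    needle u₁ lam τ v s - u₁ s =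
      (Icc (τ - lam / 2) (τ + lam / 2)).indicator (fun s => v - u₁ s) s := by
  by_cases h : s ∈ Icc (τ - lam / 2) (τ + lam / 2)
  · rw [needle, if_pos h, indicator_of_mem h]
  · rw [needle, if_neg h, indicator_of_notMem h, sub_self]

theorem norm_needle_le (u₁ : ℝ → U) (lam τ : ℝ) (v : U) (s : ℝ) :
    ‖needle u₁ lam τ v s‖ ≤ ‖u₁ s‖ + ‖v‖ := by
  rw [needle]
  split_ifs <;> simp

theorem intervalIntegrable_needle {u₁ : ℝ → U} {a b : ℝ} (hu₁ : IntervalIntegrable u₁ volume a b)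
    (lam τ : ℝ) (v : U) : IntervalIntegrable (needle u₁ lam τ v) volume a b := by
  have h : needle u₁ lam τ v =
      u₁ + (Icc (τ - lam / 2) (τ + lam / 2)).indicator fun s => v - u₁ s := by
    ext1 s
    rw [Pi.add_apply, ← needle_sub_apply, add_sub_cancel]
  have hv : IntervalIntegrable (fun s => v - u₁ s) volume a b := intervalIntegrable_const.sub hu₁
  rw [h]
  refine hu₁.add ?_
  rw [intervalIntegrable_iff] at hv ⊢
  exact hv.indicator measurableSet_Icc

/-- The integral of a function that vanishes off the support of the needle. -/
theorem integral_eq_integral_needle {E : Type*} [NormedAddCommGroup E] [NormedSpace ℝ E]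
    {T lam τ : ℝ} (hlam : 0 ≤ lam) (hsub : Icc (τ - lam / 2) (τ + lam / 2) ⊆ Ioo 0 T) {g h : ℝ → E}
    (hgh : ∀ s, g s = (Icc (τ - lam / 2) (τ + lam / 2)).indicator h s) :
    ∫ s in (0 : ℝ)..T, g s = ∫ s in (τ - lam / 2)..(τ + lam / 2), h s := by
  have hle : τ - lam / 2 ≤ τ + lam / 2 := by linarith
  have h1 := hsub (left_mem_Icc.2 hle)
  simp_rw [hgh]
  rw [intervalIntegral.integral_of_le (h1.1.trans h1.2).le, intervalIntegral.integral_of_le hle,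
    setIntegral_indicator measurableSet_Icc,
    inter_eq_self_of_subset_right (hsub.trans Ioo_subset_Ioc_self), integral_Icc_eq_integral_Ioc]

/-- The product filter lets the length shrink while the position varies near τ; this is the source
of the uniformity in t at the end. -/
theorem eventually_needle_subset {τ : ℝ} {s : Set ℝ} (hs : s ∈ 𝓝 τ) :
    ∀ᶠ w in 𝓝[>] (0 : ℝ) ×ˢ 𝓝 τ, 0 < w.1 ∧ Icc (w.2 - w.1 / 2) (w.2 + w.1 / 2) ⊆ s := by
  obtain ⟨r, hr, hball⟩ := Metric.mem_nhds_iff.1 hs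
  have h1 : ∀ᶠ w in 𝓝[>] (0 : ℝ) ×ˢ 𝓝 τ, w.1 ∈ Ioo 0 r :=
    tendsto_fst.eventually (Ioo_mem_nhdsGT hr)
  have h2 : ∀ᶠ w in 𝓝[>] (0 : ℝ) ×ˢ 𝓝 τ, w.2 ∈ Metric.ball τ (r / 2) :=
    tendsto_snd.eventually (Metric.ball_mem_nhds τ (half_pos hr))
  filter_upwards [h1, h2] with w h1 h2
  refine ⟨h1.1, fun t ht => hball ?_⟩
  rw [Metric.mem_ball, Real.dist_eq, abs_lt] at h2 ⊢
  constructor <;> linarith [h1.2, ht.1, ht.2]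

end Needle

variable {H U : Type*} [NormedAddCommGroup H] [InnerProductSpace ℝ H]
  [NormedAddCommGroup U] [InnerProductSpace ℝ U] {Q : StageProblem H U}

theorem HasUniqueState.isMildSolution_state {u : ℝ → U} (h : Q.HasUniqueState u) :
    Q.IsMildSolution u (Q.state u) := by
  obtain ⟨y, hy, -⟩ := h
  have hex : ∃ y, Q.IsMildSolution u y := ⟨y, hy⟩
  rw [state, dif_pos hex]
  exact hex.choose_spec

theorem HasUniqueState.eqOn {u : ℝ → U} (h : Q.HasUniqueState u) {y z : ℝ → H}
    (hy : Q.IsMildSolution u y) (hz : Q.IsMildSolution u z) : EqOn y z (Icc 0 Q.T) := by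
  obtain ⟨x, -, hx⟩ := h
  exact (hx y hy).trans (hx z hz).symm

theorem HasUniqueState.cost_eq {u : ℝ → U} (h : Q.HasUniqueState u) (hT : 0 ≤ Q.T) {y : ℝ → H}
    (hy : Q.IsMildSolution u y) :
    Q.cost u = (∫ s in (0 : ℝ)..Q.T, Q.l₁ (y s)) + Q.m (y Q.T) := by
  have he := h.eqOn h.isMildSolution_state hy
  rw [cost, he ⟨hT, le_rfl⟩]
  congr 1
  refine intervalIntegral.integral_congr fun s hs => ?_
  rw [uIcc_of_le hT] at hs
  simp only [he hs]

namespace Assumptions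

/-- Dominated convergence: at each interior time the quotient vanishes by differentiability. The
majorant 2|K|B takes one |K|B from the increment of the Hamiltonian and one from its linear part. -/
theorem tendsto_integral_remainder_div (hQ : Q.Assumptions) {u : ℝ → U}
    (hu : IntervalIntegrable u volume 0 Q.T) {y : ℝ → H} (hy : ContinuousOn y (Icc 0 Q.T))
    {p : ℝ → H →L[ℝ] ℝ} (hp : ContinuousOn p (Icc 0 Q.T)) {ι : Type*} {l : Filter ι}
    [l.IsCountablyGenerated] {lam : ι → ℝ} (hlam : Tendsto lam l (𝓝 0))
    {z : ι → ℝ → H} {K : ℝ} (hz : ∀ᶠ i in l, ContinuousOn (z i) (Icc 0 Q.T) ∧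
      ∀ t ∈ Icc 0 Q.T, ‖z i t - y t‖ ≤ K * ‖lam i‖) :
    Tendsto (fun i => (∫ s in (0 : ℝ)..Q.T, (Q.hamiltonian u p s (z i s) -
      Q.hamiltonian u p s (y s) - Q.adjointSource u y p s (z i s - y s))) / lam i) l (𝓝 0) := by
  have hT := hQ.T_pos.le
  obtain ⟨δ, hδ, B, hB, hlip, hqB⟩ := hQ.exists_hamiltonian_tube hu hy hp
  have hum := ((intervalIntegrable_iff_integrableOn_Ioc_of_le hT).1 hu).1
  have hmeas : ∀ {x : ℝ → H}, ContinuousOn x (Icc 0 Q.T) →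
      AEStronglyMeasurable x (volume.restrict (Ioc 0 Q.T)) := fun hx =>
    (hx.mono Ioc_subset_Icc_self).aestronglyMeasurable measurableSet_Ioc
  have hid := Measure.QuasiMeasurePreserving.id (volume.restrict (Ioc 0 Q.T))
  have hsmall : ∀ᶠ i in l, K * ‖lam i‖ ≤ δ := by
    have : Tendsto (fun i => K * ‖lam i‖) l (𝓝 0) := by simpa using hlam.norm.const_mul K
    exact (this.eventually_lt_const hδ).mono fun _ h => h.le
  simp_rw [← intervalIntegral.integral_div]
  have hzero : ∫ _ in (0 : ℝ)..Q.T, (0 : ℝ) = 0 := intervalIntegral.integral_zero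
  refine Eq.subst (motive := fun c => Tendsto _ l (𝓝 c)) hzero ?_
  refine intervalIntegral.tendsto_integral_filter_of_dominated_convergence
    (fun s => 2 * |K| * B s) ?_ ?_ (hB.const_mul _) ?_
  · rw [uIoc_of_le hT]
    filter_upwards [hz] with i hi
    have := ((hQ.aestronglyMeasurable_hamiltonian hid hum hp (hmeas hi.1)).sub
      (hQ.aestronglyMeasurable_hamiltonian hid hum hp (hmeas hy))).sub
      (hQ.aestronglyMeasurable_adjointSource_apply hid hum hy hp
        ((hmeas hi.1).sub (hmeas hy)))
    simpa [div_eq_mul_inv] using this.mul_const (lam i)⁻¹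
  · filter_upwards [hz, hsmall] with i hi hiδ
    rw [uIoc_of_le hT, ← ae_restrict_iff' measurableSet_Ioc]
    refine ae_mem_Ioo_of_restrict_Ioc.mono fun s hs => ?_
    have hw := hi.2 s (Ioo_subset_Icc_self hs)
    have h1 := hlip s hs (z i s) (y s) (hw.trans hiδ) (by simpa using hδ.le)
    have h2 := (Q.adjointSource u y p s).le_of_opNorm_le (hqB s hs).2 (z i s - y s)
    have h3 : ‖z i s - y s‖ ≤ |K| * ‖lam i‖ :=
      hw.trans (mul_le_mul_of_nonneg_right (le_abs_self K) (norm_nonneg _))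
    have h4 := mul_le_mul_of_nonneg_left h3 (hqB s hs).1
    rw [norm_div]
    refine div_le_of_le_mul₀ (norm_nonneg _) (mul_nonneg (by positivity) (hqB s hs).1) ?_
    refine (norm_sub_le _ _).trans ?_
    nlinarith
  · rw [uIoc_of_le hT, ← ae_restrict_iff' measurableSet_Ioc]
    refine ae_mem_Ioo_of_restrict_Ioc.mono fun s hs => ?_
    exact (hQ.hasFDerivAt_hamiltonian u y p hs).tendsto_remainder_div hlam
      (hz.mono fun i hi => hi.2 s (Ioo_subset_Icc_self hs))

variable [CompleteSpace H]

/-- The exact increment of the cost, in terms of the Hamiltonian. -/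
theorem cost_increment (hQ : Q.Assumptions) {u₁ u : ℝ → U}
    (hu₁ : IntervalIntegrable u₁ volume 0 Q.T) (hu : IntervalIntegrable u volume 0 Q.T)
    {y z : ℝ → H} (hy : Q.IsMildSolution u₁ y) (hz : Q.IsMildSolution u z)
    {p : ℝ → H →L[ℝ] ℝ} (hp : Q.IsMildAdjoint u₁ y p) :
    ((∫ s in (0 : ℝ)..Q.T, Q.l₁ (z s)) + Q.m (z Q.T)) -
      ((∫ s in (0 : ℝ)..Q.T, Q.l₁ (y s)) + Q.m (y Q.T)) =
    (Q.m (z Q.T) - Q.m (y Q.T) - fderiv ℝ Q.m (y Q.T) (z Q.T - y Q.T)) +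
      (∫ s in (0 : ℝ)..Q.T, (Q.hamiltonian u₁ p s (z s) - Q.hamiltonian u₁ p s (y s) -
        Q.adjointSource u₁ y p s (z s - y s))) +
      ∫ s in (0 : ℝ)..Q.T, p s (Q.f s (z s) (u s - u₁ s)) := by
  have hT := hQ.T_pos.le
  have hiz := hQ.intervalIntegrable_input hz.continuousOn hu
  have hiy := hQ.intervalIntegrable_input hy.continuousOn hu₁
  have hF := hiz.sub hiy
  have hW : ∀ t ∈ Icc 0 Q.T,
      ∫ s in (0 : ℝ)..t, Q.S (t - s) (Q.f s (z s) (u s) - Q.f s (y s) (u₁ s)) = z t - y t := by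
    intro t ht
    rw [hz.eq t ht, hy.eq t ht, add_sub_add_left_eq_sub, ← intervalIntegral.integral_sub
      (hz.integrable t ht) (hy.integrable t ht)]
    simp only [map_sub]
  -- Duality for the source f(z)u - f(y)u₁, whose convolution is z - y by `hW`.
  have hdual := hQ.integral_adjoint_apply hu₁ hy.continuousOn hp hF
  rw [hW Q.T ⟨hT, le_rfl⟩, hp.terminal] at hdual
  have hcongr : ∫ s in (0 : ℝ)..Q.T, Q.adjointSource u₁ y p s
      (∫ r in (0 : ℝ)..s, Q.S (s - r) (Q.f r (z r) (u r) - Q.f r (y r) (u₁ r))) =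
      ∫ s in (0 : ℝ)..Q.T, Q.adjointSource u₁ y p s (z s - y s) := by
    refine intervalIntegral.integral_congr fun s hs => ?_
    rw [uIcc_of_le hT] at hs
    simp only [hW s hs]
  rw [hcongr] at hdual
  have hpi : ∀ {F : ℝ → H}, IntervalIntegrable F volume 0 Q.T →
      IntervalIntegrable (fun s => p s (F s)) volume 0 Q.T := by
    intro F hF
    obtain ⟨P, hP⟩ := isCompact_Icc.bddAbove_image hp.continuousOn.norm
    rw [intervalIntegrable_iff_integrableOn_Ioc_of_le hT] at hF ⊢
    refine (hF.norm.const_mul P).mono'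
      ((isBoundedBilinearMap_apply (𝕜 := ℝ) (E := H)
        (F := ℝ)).continuous.comp_aestronglyMeasurable
        (((hp.continuousOn.mono Ioc_subset_Icc_self).aestronglyMeasurable
          measurableSet_Ioc).prodMk hF.1)) ?_
    exact (ae_restrict_mem measurableSet_Ioc).mono fun t ht =>
      (p t).le_of_opNorm_le (hP (mem_image_of_mem _ (Ioc_subset_Icc_self ht))) _
  have hlc : ∀ {x : ℝ → H}, ContinuousOn x (Icc 0 Q.T) →
      IntervalIntegrable (fun s => Q.l₁ (x s)) volume 0 Q.T := fun hx =>
    ContinuousOn.intervalIntegrable (by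
      rw [uIcc_of_le hT]; exact hQ.l₁_contDiff.continuous.comp_continuousOn hx)
  have hq : IntervalIntegrable (fun s => Q.adjointSource u₁ y p s (z s - y s)) volume 0 Q.T := by
    obtain ⟨-, -, B, hB, -, hqB⟩ := hQ.exists_hamiltonian_tube hu₁ hy.continuousOn hp.continuousOn
    have hw := hz.continuousOn.sub hy.continuousOn
    obtain ⟨D, hD⟩ := isCompact_Icc.bddAbove_image hw.norm
    rw [intervalIntegrable_iff_integrableOn_Ioc_of_le hT] at hB hu₁ ⊢
    refine (hB.mul_const D).mono' (hQ.aestronglyMeasurable_adjointSource_apply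
      (Measure.QuasiMeasurePreserving.id _) hu₁.1 hy.continuousOn hp.continuousOn
      ((hw.mono Ioc_subset_Icc_self).aestronglyMeasurable measurableSet_Ioc)) ?_
    exact ae_mem_Ioo_of_restrict_Ioc.mono fun s hs =>
      (Q.adjointSource u₁ y p s).le_of_opNorm_le_of_le (hqB s hs).2
        (hD (mem_image_of_mem _ (Ioo_subset_Icc_self hs)))
  have hn := hpi (hQ.intervalIntegrable_input hz.continuousOn (hu.sub hu₁))
  have hpF := hpi hF
  -- Writing f(z)u₁ as f(z)u - f(z)(u - u₁) isolates the control variation at the perturbed state,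
  -- which keeps the formula exact.
  have hsplit : ∀ s, Q.hamiltonian u₁ p s (z s) - Q.hamiltonian u₁ p s (y s) -
      Q.adjointSource u₁ y p s (z s - y s) =
      Q.l₁ (z s) - Q.l₁ (y s) + p s (Q.f s (z s) (u s) - Q.f s (y s) (u₁ s)) -
        p s (Q.f s (z s) (u s - u₁ s)) - Q.adjointSource u₁ y p s (z s - y s) := by
    intro s
    simp only [hamiltonian, map_sub]
    ring
  simp_rw [hsplit]
  rw [intervalIntegral.integral_sub ((((hlc hz.continuousOn).sub (hlc hy.continuousOn)).add
      hpF).sub hn) hq, intervalIntegral.integral_sub (((hlc hz.continuousOn).sub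
      (hlc hy.continuousOn)).add hpF) hn, intervalIntegral.integral_add
      ((hlc hz.continuousOn).sub (hlc hy.continuousOn)) hpF,
    intervalIntegral.integral_sub (hlc hz.continuousOn) (hlc hy.continuousOn), hdual]
  ring

end Assumptions

end StageProblem

/-! ### The SAC subproblem -/

/-- A penalised quadratic functional has a unique minimiser, at which a nonzero functional `P` can
be made as small as desired by the choice of the target value. -/
theorem exists_target_minimizer_lt {U : Type*} [NormedAddCommGroup U] [InnerProductSpace ℝ U]
    [CompleteSpace U] {R : U →L[ℝ] U} (hR : IsSelfAdjoint R) {γ : ℝ} (hγ : 0 < γ)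
    (hRγ : ∀ v : U, γ * ‖v‖ ^ 2 ≤ inner ℝ (R v) v) {P : U →L[ℝ] ℝ} (hP : P ≠ 0) (c : ℝ) :
    ∃ α < 0, (∃ v, IsMinOn (fun v => 1 / 2 * (P v - c - α) ^ 2 + 1 / 2 * inner ℝ v (R v)) univ v) ∧
      ∀ v, IsMinOn (fun v => 1 / 2 * (P v - c - α) ^ 2 + 1 / 2 * inner ℝ v (R v)) univ v →
        P v < c := by
  have hcoer : IsCoercive ((innerSL ℝ).comp R : U →L[ℝ] U →L[ℝ] ℝ) :=
    ⟨γ, hγ, fun u => by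
      have := hRγ u
      simp only [ContinuousLinearMap.comp_apply, innerSL_apply_apply]
      nlinarith⟩
  -- Lax–Milgram for the form ⟨Rx, y⟩: e is R⁻¹ applied to the Riesz representative of P.
  obtain ⟨e, he⟩ : ∃ e : U, ∀ x, inner ℝ (R e) x = P x := by
    refine ⟨hcoer.continuousLinearEquivOfBilin.symm ((InnerProductSpace.toDual ℝ U).symm P),
      fun x => ?_⟩
    have := hcoer.continuousLinearEquivOfBilin_apply
      (hcoer.continuousLinearEquivOfBilin.symm ((InnerProductSpace.toDual ℝ U).symm P)) x
    rw [ContinuousLinearEquiv.apply_symm_apply, InnerProductSpace.toDual_symm_apply] at this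
    rw [this]
    rfl
  have he0 : e ≠ 0 := by
    rintro rfl
    exact hP (ContinuousLinearMap.ext fun x => by simp [← he x])
  have hsymm : ∀ x y : U, inner ℝ (R x) y = inner ℝ x (R y) := fun x y => hR.isSymmetric x y
  obtain ⟨β, hβ⟩ : ∃ β, P e = β := ⟨_, rfl⟩
  have hβ0 : 0 < β := by
    rw [← hβ, ← he e]
    exact (mul_pos hγ (pow_pos (norm_pos_iff.2 he0) 2)).trans_le (hRγ e)
  -- The minimizer will have P-value β(c + α)/(1 + β), which is below c exactly when βα < c; this α
  -- gives βα = -|c| - β.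
  set α : ℝ := -(|c| / β + 1) with hα
  have hα0 : α < 0 := by
    have : 0 ≤ |c| / β := by positivity
    linarith
  have hαβ : β * α < c := by
    have : β * α = -|c| - β := by rw [hα]; field_simp; ring
    linarith [neg_abs_le c]
  -- Stationarity reads (P v - c - α)P + ⟨Rv, ·⟩ = 0, so v = κe with κβ - c - α = -κ. The linear
  -- terms of the expansion at κe then cancel, leaving a positive definite quadratic.
  set κ : ℝ := (c + α) / (1 + β) with hκ
  have hκe : κ * β - c - α = -κ := by rw [hκ]; field_simp; ring
  have hexp : ∀ v, 1 / 2 * (P v - c - α) ^ 2 + 1 / 2 * inner ℝ v (R v) =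
      1 / 2 * (P (κ • e) - c - α) ^ 2 + 1 / 2 * inner ℝ (κ • e) (R (κ • e)) +
        1 / 2 * P (v - κ • e) ^ 2 + 1 / 2 * inner ℝ (R (v - κ • e)) (v - κ • e) := by
    intro v
    have h1 : inner ℝ e (R v) = P v := by rw [← hsymm, he]
    have h2 : inner ℝ e (R e) = β := by rw [← hsymm, he, hβ]
    have h3 : inner ℝ (R v) e = P v := by rw [real_inner_comm, h1]
    have h4 : inner ℝ (R v) v = inner ℝ v (R v) := hsymm v v
    simp only [map_sub, map_smul, inner_sub_left, inner_sub_right, real_inner_smul_left,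
      real_inner_smul_right, smul_eq_mul, he, h2, h3, h4, hβ]
    linear_combination (P v - κ * β) * hκe
  have hpos : ∀ h : U, γ / 2 * ‖h‖ ^ 2 ≤ 1 / 2 * P h ^ 2 + 1 / 2 * inner ℝ (R h) h := fun h => by
    nlinarith [hRγ h, sq_nonneg (P h)]
  refine ⟨α, hα0, ⟨κ • e, fun v _ => ?_⟩, fun v hv => ?_⟩
  · have h1 := hexp v
    have h2 := hpos (v - κ • e)
    have h3 : 0 ≤ γ / 2 * ‖v - κ • e‖ ^ 2 := by positivity
    simp only [mem_ofPred_eq]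
    linarith
  · have h1 := hexp v
    have h2 := hpos (v - κ • e)
    have h3 := hv (mem_univ (κ • e))
    simp only [mem_ofPred_eq] at h3
    have h4 : ‖v - κ • e‖ ^ 2 ≤ 0 := by
      by_contra! h
      have : 0 < γ / 2 * ‖v - κ • e‖ ^ 2 := by positivity
      linarith
    have h5 : v = κ • e := by
      have := pow_eq_zero_iff (two_ne_zero) |>.1 (le_antisymm h4 (by positivity))
      rwa [norm_eq_zero, sub_eq_zero] at this
    rw [h5, map_smul, smul_eq_mul, hβ, hκ, div_mul_eq_mul_div, div_lt_iff₀ (by positivity)]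
    nlinarith

/-! ### Limit of the difference quotients, jointly in needle length and position -/

namespace StageProblem

variable {H U : Type*} [NormedAddCommGroup H] [InnerProductSpace ℝ H]
  [NormedAddCommGroup U] [InnerProductSpace ℝ U] {Q : StageProblem H U}

namespace Assumptions

theorem continuousOn_adjoint_input (hQ : Q.Assumptions) {u : ℝ → U}
    (hu : ContinuousOn u (Ioo 0 Q.T)) {z : ℝ → H} (hz : ContinuousOn z (Icc 0 Q.T))
    {p : ℝ → H →L[ℝ] ℝ} (hp : ContinuousOn p (Icc 0 Q.T)) (v : U) :
    ContinuousOn (fun s => p s (Q.f s (z s) (v - u s))) (Ioo 0 Q.T) :=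
  (hp.mono Ioo_subset_Icc_self).clm_apply (((hQ.continuousOn_f hz).mono
    Ioo_subset_Icc_self).clm_apply (continuousOn_const.sub hu))

/-- The quotient is the mean over the needle of a function of (s, z(s)) that is jointly continuous
at (τ, y(τ)), and (s, z(s)) stays close to that point along the needle. -/
theorem tendsto_integral_needle_div (hQ : Q.Assumptions) {u₁ : ℝ → U}
    (hu₁ : ContinuousOn u₁ (Ioo 0 Q.T)) {y : ℝ → H} (hy : ContinuousOn y (Icc 0 Q.T))
    {p : ℝ → H →L[ℝ] ℝ} (hp : ContinuousOn p (Icc 0 Q.T)) {τ : ℝ} (hτ : τ ∈ Ioo 0 Q.T) (v : U)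
    {z : ℝ × ℝ → ℝ → H} {K : ℝ} (hz : ∀ᶠ w in 𝓝[>] (0 : ℝ) ×ˢ 𝓝 τ,
      ContinuousOn (z w) (Icc 0 Q.T) ∧ ∀ t ∈ Icc 0 Q.T, ‖z w t - y t‖ ≤ K * ‖w.1‖) :
    Tendsto (fun w => (∫ s in (0 : ℝ)..Q.T,
        p s (Q.f s (z w s) (needle u₁ w.1 w.2 v s - u₁ s))) / w.1)
      (𝓝[>] (0 : ℝ) ×ˢ 𝓝 τ) (𝓝 (p τ (Q.f τ (y τ) (v - u₁ τ)))) := by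
  have hI : Ioo 0 Q.T ∈ 𝓝 τ := isOpen_Ioo.mem_nhds hτ
  have hIcc : Icc 0 Q.T ∈ 𝓝 τ := mem_of_superset hI Ioo_subset_Icc_self
  have hlam : Tendsto (fun w : ℝ × ℝ => w.1) (𝓝[>] (0 : ℝ) ×ˢ 𝓝 τ) (𝓝 0) :=
    tendsto_fst.mono_right nhdsWithin_le_nhds
  set G := p τ (Q.f τ (y τ) (v - u₁ τ)) with hG
  have hφ : ContinuousAt (fun w : ℝ × H => p w.1 (Q.extendedF w.1 w.2 (v - u₁ w.1))) (τ, y τ) := by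
    have h1 : ContinuousAt (fun w : ℝ × H => p w.1) (τ, y τ) :=
      ContinuousAt.comp (f := Prod.fst) (g := p) (hp.continuousAt hIcc) continuousAt_fst
    have h2 : ContinuousAt (fun w : ℝ × H => u₁ w.1) (τ, y τ) :=
      ContinuousAt.comp (f := Prod.fst) (g := u₁) (hu₁.continuousAt hI) continuousAt_fst
    exact h1.clm_apply (hQ.continuous_extendedF.continuousAt.clm_apply (continuousAt_const.sub h2))
  rw [Metric.tendsto_nhds]
  intro ε hε
  have hnear : ∀ᶠ w : ℝ × H in 𝓝 (τ, y τ),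
      ‖p w.1 (Q.extendedF w.1 w.2 (v - u₁ w.1)) - G‖ < ε / 2 := by
    have h1 := (hφ.sub_const G).norm
    refine Tendsto.eventually_lt_const (u := ε / 2) ?_ h1
    simpa [hG, Q.extendedF_eq (Ioo_subset_Icc_self hτ)] using hε
  obtain ⟨r, hr, hball⟩ := Metric.eventually_nhds_iff_ball.1 hnear
  have hynear : {s | s ∈ Ioo 0 Q.T ∧ s ∈ Metric.ball τ r ∧ ‖y s - y τ‖ < r / 2} ∈ 𝓝 τ := by
    have h1 : ∀ᶠ s in 𝓝 τ, ‖y s - y τ‖ < r / 2 := by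
      refine Tendsto.eventually_lt_const (u := r / 2) ?_
        ((hy.continuousAt hIcc).sub_const (y τ)).norm
      simpa using hr
    filter_upwards [hI, Metric.ball_mem_nhds τ hr, h1] with s h1 h2 h3 using ⟨h1, h2, h3⟩
  have hKsmall : ∀ᶠ w : ℝ × ℝ in 𝓝[>] (0 : ℝ) ×ˢ 𝓝 τ, K * ‖w.1‖ < r / 2 := by
    have : Tendsto (fun w : ℝ × ℝ => K * ‖w.1‖) (𝓝[>] (0 : ℝ) ×ˢ 𝓝 τ) (𝓝 0) := by
      simpa using hlam.norm.const_mul K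
    exact this.eventually_lt_const (half_pos hr)
  filter_upwards [hz, hKsmall, eventually_needle_subset hynear] with w hzw hKw hw
  obtain ⟨hw0, hsub⟩ := hw
  have hle : w.2 - w.1 / 2 ≤ w.2 + w.1 / 2 := by linarith
  have hsub' : Icc (w.2 - w.1 / 2) (w.2 + w.1 / 2) ⊆ Ioo 0 Q.T := fun s hs => (hsub hs).1
  rw [integral_eq_integral_needle hw0.le hsub' (h := fun s => p s (Q.f s (z w s) (v - u₁ s)))
    (fun s => by
      rw [needle_sub_apply]
      by_cases hs : s ∈ Icc (w.2 - w.1 / 2) (w.2 + w.1 / 2)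
      · rw [indicator_of_mem hs, indicator_of_mem hs]
      · rw [indicator_of_notMem hs, indicator_of_notMem hs, map_zero, map_zero])]
  have hint : IntervalIntegrable (fun s => p s (Q.f s (z w s) (v - u₁ s))) volume
      (w.2 - w.1 / 2) (w.2 + w.1 / 2) :=
    ContinuousOn.intervalIntegrable (by
      rw [uIcc_of_le hle]
      exact (hQ.continuousOn_adjoint_input hu₁ hzw.1 hp v).mono hsub')
  have hbound : ‖∫ s in (w.2 - w.1 / 2)..(w.2 + w.1 / 2),
      (p s (Q.f s (z w s) (v - u₁ s)) - G)‖ ≤ ε / 2 * |w.2 + w.1 / 2 - (w.2 - w.1 / 2)| := by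
    refine intervalIntegral.norm_integral_le_of_norm_le_const fun s hs => ?_
    rw [uIoc_of_le hle] at hs
    obtain ⟨hsI, hsr, hsy⟩ := hsub (Ioc_subset_Icc_self hs)
    have hsI' := Ioo_subset_Icc_self hsI
    have hzs : ‖z w s - y τ‖ < r := by
      have := norm_sub_le_norm_sub_add_norm_sub (z w s) (y s) (y τ)
      linarith [hzw.2 s hsI']
    have := hball (s, z w s) (by
      rw [Metric.mem_ball, Prod.dist_eq, max_lt_iff, dist_eq_norm (z w s)]
      exact ⟨hsr, hzs⟩)
    simp only [Q.extendedF_eq hsI'] at this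
    exact this.le
  rw [intervalIntegral.integral_sub hint intervalIntegrable_const,
    intervalIntegral.integral_const, smul_eq_mul,
    show w.2 + w.1 / 2 - (w.2 - w.1 / 2) = w.1 by ring, abs_of_pos hw0] at hbound
  rw [Real.dist_eq, ← Real.norm_eq_abs]
  have hdiv : (∫ s in (w.2 - w.1 / 2)..(w.2 + w.1 / 2), p s (Q.f s (z w s) (v - u₁ s))) / w.1 - G =
      ((∫ s in (w.2 - w.1 / 2)..(w.2 + w.1 / 2), p s (Q.f s (z w s) (v - u₁ s))) - w.1 * G) /
        w.1 := by
    field_simp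
  rw [hdiv, norm_div, Real.norm_of_nonneg hw0.le, div_lt_iff₀ hw0]
  nlinarith

variable [CompleteSpace H]

theorem hasUniqueState_of_norm_le (hQ : Q.Assumptions) {u : ℝ → U}
    (hu : IntervalIntegrable u volume 0 Q.T) {κ : ℝ → ℝ} (hκ : ContinuousOn κ (Ioo 0 Q.T))
    (hκi : IntervalIntegrable κ volume 0 Q.T) (huκ : ∀ t, ‖u t‖ ≤ κ t) {y : ℝ → H}
    (hy : Q.IsMildSolution u y) : Q.HasUniqueState u :=
  ⟨y, hy, fun _ hz => hQ.isMildSolution_unique hu hκ hκi huκ hy hz⟩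

/-- The states of short needle variations exist, are unique, and differ from the reference state
by at most a multiple of the length of the needle, locally uniformly in the needle's position. -/
theorem eventually_hasUniqueState_needle (hQ : Q.Assumptions) {u₁ : ℝ → U}
    (hu₁ : ContinuousOn u₁ (Ioo 0 Q.T)) (hu₁i : IntervalIntegrable u₁ volume 0 Q.T) {y : ℝ → H}
    (hy : Q.IsMildSolution u₁ y) {τ : ℝ} (hτ : τ ∈ Ioo 0 Q.T) (v : U) :
    ∃ K : ℝ, ∀ᶠ w in 𝓝[>] (0 : ℝ) ×ˢ 𝓝 τ, Q.HasUniqueState (needle u₁ w.1 w.2 v) ∧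
      ∀ t ∈ Icc 0 Q.T, ‖Q.state (needle u₁ w.1 w.2 v) t - y t‖ ≤ K * ‖w.1‖ := by
  have hI : Ioo 0 Q.T ∈ 𝓝 τ := isOpen_Ioo.mem_nhds hτ
  have hκ : ContinuousOn (fun s => ‖u₁ s‖ + ‖v‖) (Ioo 0 Q.T) := hu₁.norm.add continuousOn_const
  have hκi : IntervalIntegrable (fun s => ‖u₁ s‖ + ‖v‖) volume 0 Q.T :=
    hu₁i.norm.add intervalIntegrable_const
  obtain ⟨L, hL, η, hη, hex⟩ := hQ.exists_isMildSolution_near hu₁i hκ (fun s => by positivity)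
    hκi hy
  -- D bounds v - u₁ near τ by continuity of u₁, so a needle of length λ there changes the control
  -- by at most Dλ in L¹.
  obtain ⟨D, hD⟩ : ∃ D, ‖v - u₁ τ‖ < D := exists_gt _
  have hD0 : 0 < D := (norm_nonneg _).trans_lt hD
  have hnear : {s | s ∈ Ioo 0 Q.T ∧ ‖v - u₁ s‖ < D} ∈ 𝓝 τ :=
    (eventually_mem_set.2 hI).and
      ((hu₁.continuousAt hI).const_sub v |>.norm |>.eventually_lt_const hD)
  have hsmall : ∀ᶠ w : ℝ × ℝ in 𝓝[>] (0 : ℝ) ×ˢ 𝓝 τ, D * w.1 < η := by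
    have : Tendsto (fun w : ℝ × ℝ => D * w.1) (𝓝[>] (0 : ℝ) ×ˢ 𝓝 τ) (𝓝 0) := by
      simpa using (tendsto_fst.mono_right (nhdsWithin_le_nhds (a := (0 : ℝ)))).const_mul D
    exact this.eventually_lt_const hη
  refine ⟨L * D, ?_⟩
  filter_upwards [hsmall, eventually_needle_subset hnear] with w hwη hw
  obtain ⟨hw0, hsub⟩ := hw
  have hle : w.2 - w.1 / 2 ≤ w.2 + w.1 / 2 := by linarith
  have hni := intervalIntegrable_needle hu₁i w.1 w.2 v
  have hnorm : ∫ s in (0 : ℝ)..Q.T, ‖needle u₁ w.1 w.2 v s - u₁ s‖ ≤ D * w.1 := by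
    rw [integral_eq_integral_needle hw0.le (fun s hs => (hsub hs).1)
      (h := fun s => ‖v - u₁ s‖) (fun s => by
        rw [needle_sub_apply, norm_indicator_eq_indicator_norm])]
    refine (Real.le_norm_self _).trans ?_
    have := intervalIntegral.norm_integral_le_of_norm_le_const (a := w.2 - w.1 / 2)
      (b := w.2 + w.1 / 2) (f := fun s => ‖v - u₁ s‖) (C := D) fun s hs => by
        rw [uIoc_of_le hle] at hs
        rw [norm_norm]
        exact (hsub (Ioc_subset_Icc_self hs)).2.le
    rwa [show w.2 + w.1 / 2 - (w.2 - w.1 / 2) = w.1 by ring, abs_of_pos hw0] at this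
  obtain ⟨z, hz, hzy⟩ := hex _ hni (norm_needle_le u₁ w.1 w.2 v) (hnorm.trans hwη.le)
  have hun := hQ.hasUniqueState_of_norm_le hni hκ hκi (norm_needle_le u₁ w.1 w.2 v) hz
  refine ⟨hun, fun t ht => ?_⟩
  rw [hun.eqOn hun.isMildSolution_state hz ht, Real.norm_of_nonneg hw0.le, mul_assoc]
  exact (hzy t ht).trans (mul_le_mul_of_nonneg_left hnorm hL)

/-- The difference quotients of the cost converge, locally uniformly in the application time. -/
theorem tendsto_migQuotient (hQ : Q.Assumptions) {u₁ : ℝ → U}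
    (hu₁ : ContinuousOn u₁ (Ioo 0 Q.T)) (hu₁i : IntervalIntegrable u₁ volume 0 Q.T) {y : ℝ → H}
    (hy : Q.IsMildSolution u₁ y) (hun : Q.HasUniqueState u₁) {p : ℝ → H →L[ℝ] ℝ}
    (hp : Q.IsMildAdjoint u₁ y p) {τ : ℝ} (hτ : τ ∈ Ioo 0 Q.T) (v : U) :
    Tendsto (fun w : ℝ × ℝ => Q.migQuotient u₁ w.2 v w.1) (𝓝[>] (0 : ℝ) ×ˢ 𝓝 τ)
      (𝓝 (p τ (Q.f τ (y τ) (v - u₁ τ)))) := by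
  obtain ⟨K, hK⟩ := hQ.eventually_hasUniqueState_needle hu₁ hu₁i hy hτ v
  have hlam : Tendsto (fun w : ℝ × ℝ => w.1) (𝓝[>] (0 : ℝ) ×ˢ 𝓝 τ) (𝓝 0) :=
    tendsto_fst.mono_right nhdsWithin_le_nhds
  have hz : ∀ᶠ w in 𝓝[>] (0 : ℝ) ×ˢ 𝓝 τ,
      ContinuousOn (Q.state (needle u₁ w.1 w.2 v)) (Icc 0 Q.T) ∧
      ∀ t ∈ Icc 0 Q.T, ‖Q.state (needle u₁ w.1 w.2 v) t - y t‖ ≤ K * ‖w.1‖ :=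
    hK.mono fun w hw => ⟨hw.1.isMildSolution_state.continuousOn, hw.2⟩
  have hTT : Q.T ∈ Icc 0 Q.T := ⟨hQ.T_pos.le, le_rfl⟩
  have hm := (hQ.m_contDiff.differentiable one_ne_zero (y Q.T)).hasFDerivAt.tendsto_remainder_div
    hlam (x := fun w => Q.state (needle u₁ w.1 w.2 v) Q.T) (hz.mono fun w hw => hw.2 _ hTT)
  have hham := hQ.tendsto_integral_remainder_div hu₁i hy.continuousOn hp.continuousOn hlam hz
  have hneedle := hQ.tendsto_integral_needle_div hu₁ hy.continuousOn hp.continuousOn hτ v hz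
  have hsum := (hm.add hham).add hneedle
  rw [zero_add, zero_add] at hsum
  refine hsum.congr' ?_
  filter_upwards [hK] with w hw
  have hzs := hw.1.isMildSolution_state
  rw [migQuotient, hw.1.cost_eq hQ.T_pos.le hzs, hun.cost_eq hQ.T_pos.le hy,
    hQ.cost_increment hu₁i (intervalIntegrable_needle hu₁i w.1 w.2 v) hy hzs hp, add_div, add_div]

theorem tendsto_migQuotient_nhdsGT (hQ : Q.Assumptions) {u₁ : ℝ → U}
    (hu₁ : ContinuousOn u₁ (Ioo 0 Q.T)) (hu₁i : IntervalIntegrable u₁ volume 0 Q.T) {y : ℝ → H}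
    (hy : Q.IsMildSolution u₁ y) (hun : Q.HasUniqueState u₁) {p : ℝ → H →L[ℝ] ℝ}
    (hp : Q.IsMildAdjoint u₁ y p) {τ : ℝ} (hτ : τ ∈ Ioo 0 Q.T) (v : U) :
    Tendsto (Q.migQuotient u₁ τ v) (𝓝[>] 0) (𝓝 (p τ (Q.f τ (y τ) (v - u₁ τ)))) := by
  have hpair : Tendsto (fun lam : ℝ => (lam, τ)) (𝓝[>] 0) (𝓝[>] (0 : ℝ) ×ˢ 𝓝 τ) :=
    tendsto_id.prodMk tendsto_const_nhds
  have h := (hQ.tendsto_migQuotient hu₁ hu₁i hy hun hp hτ v).comp hpair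
  exact h

theorem mig_eq (hQ : Q.Assumptions) {u₁ : ℝ → U}
    (hu₁ : ContinuousOn u₁ (Ioo 0 Q.T)) (hu₁i : IntervalIntegrable u₁ volume 0 Q.T) {y : ℝ → H}
    (hy : Q.IsMildSolution u₁ y) (hun : Q.HasUniqueState u₁) {p : ℝ → H →L[ℝ] ℝ}
    (hp : Q.IsMildAdjoint u₁ y p) {τ : ℝ} (hτ : τ ∈ Ioo 0 Q.T) (v : U) :
    Q.mig u₁ τ v = p τ (Q.f τ (y τ) (v - u₁ τ)) :=
  (hQ.tendsto_migQuotient_nhdsGT hu₁ hu₁i hy hun hp hτ v).limUnder_eq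

end Assumptions

end StageProblem

/-! ### Assembly -/

theorem corollary2p3 {H U : Type*}
    [NormedAddCommGroup H] [InnerProductSpace ℝ H] [CompleteSpace H]
    [NormedAddCommGroup U] [InnerProductSpace ℝ U] [CompleteSpace U]
    (Q : StageProblem H U) (hQ : Q.Assumptions)
    (R : U →L[ℝ] U) (hR : IsSelfAdjoint R)
    (γ : ℝ) (hγ : 0 < γ) (hRγ : ∀ v : U, γ * ‖v‖ ^ 2 ≤ inner ℝ (R v) v)
    (u₁ : ℝ → U) (hu₁ : ContinuousOn u₁ (Ioo 0 Q.T)) (hu₁_int : IntegrableOn u₁ (Ioo 0 Q.T))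
    (y : ℝ → H) (hy : Q.IsMildSolution u₁ y)
    (p : ℝ → H →L[ℝ] ℝ) (hp : Q.IsMildAdjoint u₁ y p) :
    (∀ t ∈ Ioo 0 Q.T, ∀ v : U, Q.MigExists u₁ t v) ∧
    ∀ τ ∈ Ioo 0 Q.T, (p τ).comp (Q.f τ (y τ)) ≠ 0 →
      ∃ αd < 0, (∃ v, Q.IsSACControl R u₁ αd τ v) ∧
        ∀ v, Q.IsSACControl R u₁ αd τ v →
          ∃ N ∈ 𝓝 τ, N ⊆ Ioo 0 Q.T ∧ (∀ t ∈ N, Q.mig u₁ t v < 0) ∧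
            ∃ lamBar > 0, Icc (τ - lamBar / 2) (τ + lamBar / 2) ⊆ N ∧
              ∀ t ∈ Icc (τ - lamBar / 2) (τ + lamBar / 2), ∀ lam ∈ Ioc 0 lamBar,
                Q.HasUniqueState (StageProblem.needle u₁ lam t v) ∧
                  Q.cost (StageProblem.needle u₁ lam t v) ≤ Q.cost u₁ := by
  have hu₁i : IntervalIntegrable u₁ volume 0 Q.T := by
    rwa [intervalIntegrable_iff_integrableOn_Ioo_of_le hQ.T_pos.le]
  have hun : Q.HasUniqueState u₁ :=
    hQ.hasUniqueState_of_norm_le hu₁i hu₁.norm hu₁i.norm (fun _ => le_rfl) hy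
  have hmig : ∀ t ∈ Ioo 0 Q.T, ∀ v : U, Q.mig u₁ t v = p t (Q.f t (y t) (v - u₁ t)) :=
    fun t ht v => hQ.mig_eq hu₁ hu₁i hy hun hp ht v
  refine ⟨fun t ht v => ⟨hun, ?_, ?_⟩, fun τ hτ hP => ?_⟩
  · obtain ⟨K, hK⟩ := hQ.eventually_hasUniqueState_needle hu₁ hu₁i hy ht v
    have hpair : Tendsto (fun lam : ℝ => (lam, t)) (𝓝[>] 0) (𝓝[>] (0 : ℝ) ×ˢ 𝓝 t) :=
      tendsto_id.prodMk tendsto_const_nhds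
    exact (hpair.eventually hK).mono fun _ h => h.1
  · rw [hmig t ht v]
    exact hQ.tendsto_migQuotient_nhdsGT hu₁ hu₁i hy hun hp ht v
  -- The gradient at τ is P v - c with c = P(u₁(τ)), so P v < c is precisely its negativity.
  obtain ⟨α, hα, hex, hall⟩ :=
    exists_target_minimizer_lt hR hγ hRγ hP (p τ (Q.f τ (y τ) (u₁ τ)))
  have hobj : Q.sacObjective R u₁ α τ = fun v =>
      1 / 2 * ((p τ).comp (Q.f τ (y τ)) v - p τ (Q.f τ (y τ) (u₁ τ)) - α) ^ 2 +
        1 / 2 * inner ℝ v (R v) := by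
    ext v
    rw [StageProblem.sacObjective, hmig τ hτ v, map_sub, map_sub, ContinuousLinearMap.comp_apply]
  rw [← hobj] at hex hall
  refine ⟨α, hα, hex, fun v hv => ?_⟩
  have hneg : p τ (Q.f τ (y τ) (v - u₁ τ)) < 0 := by
    rw [map_sub, map_sub, sub_neg]
    exact hall v hv
  have hI : Ioo 0 Q.T ∈ 𝓝 τ := isOpen_Ioo.mem_nhds hτ
  have hN : {t | t ∈ Ioo 0 Q.T ∧ p t (Q.f t (y t) (v - u₁ t)) < 0} ∈ 𝓝 τ :=
    (eventually_mem_set.2 hI).and (((hQ.continuousOn_adjoint_input hu₁ hy.continuousOn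
      hp.continuousOn v).continuousAt hI).eventually_lt_const hneg)
  refine ⟨_, hN, fun t ht => ht.1, fun t ht => (hmig t ht.1 v).trans_lt ht.2, ?_⟩
  obtain ⟨K, hK⟩ := hQ.eventually_hasUniqueState_needle hu₁ hu₁i hy hτ v
  -- The strictly negative limit makes the quotient negative for all pairs (length, position) near
  -- (0, τ).
  have hgood : ∀ᶠ w in 𝓝[>] (0 : ℝ) ×ˢ 𝓝 τ, Q.HasUniqueState (StageProblem.needle u₁ w.1 w.2 v) ∧
      Q.cost (StageProblem.needle u₁ w.1 w.2 v) ≤ Q.cost u₁ := by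
    filter_upwards [hK, (hQ.tendsto_migQuotient hu₁ hu₁i hy hun hp hτ v).eventually_lt_const hneg,
      StageProblem.eventually_needle_subset hI] with w hw hlt hw0
    refine ⟨hw.1, ?_⟩
    rw [StageProblem.migQuotient, div_neg_iff] at hlt
    rcases hlt with h | h
    · linarith [h.2, hw0.1]
    · linarith [h.1]
  obtain ⟨s, hs, N', hN', hsub⟩ := mem_prod_iff.1 hgood
  obtain ⟨ε, hε, hεs⟩ := (mem_nhdsGT_iff_exists_Ioc_subset (a := (0 : ℝ))).1 hs
  -- A rectangle inside the good set of pairs gives one duration for all positions; r places those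
  -- positions both in the rectangle and where the gradient is negative.
  obtain ⟨r, hr, hball⟩ := Metric.nhds_basis_closedBall.mem_iff.1 (inter_mem hN hN')
  have hle : ∀ t ∈ Icc (τ - min ε r / 2) (τ + min ε r / 2), t ∈ Metric.closedBall τ r := by
    intro t ht
    have h1 : min ε r ≤ r := min_le_right _ _
    rw [Real.closedBall_eq_Icc]
    constructor <;> linarith [ht.1, ht.2]
  refine ⟨min ε r, lt_min hε hr, fun t ht => (hball (hle t ht)).1, fun t ht lam hlam => ?_⟩
  exact hsub (mk_mem_prod (hεs ⟨hlam.1, hlam.2.trans (min_le_left _ _)⟩) (hball (hle t ht)).2)
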